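/- Let $p$ be an odd prime and let $S$ be a finite $p$-group which is not cyclic. A fusion system $\mathcal F$ over $S$ is a category whose objects are the subgroups of $S$ and whose morphism sets $\mathrm{Hom}_{\mathcal F}(P,Q)$ consist of injective group homomorphisms $P\to Q$, composed as maps, and contain every conjugation map $c_g:P\to Q$, $x\mapsto gxg^{-1}$, with $g\in S$ and $gPg^{-1}\le Q$, such that every morphism is an isomorphism of $\mathcal F$ followed by an inclusion. Write $\mathrm{Aut}_{\mathcal F}(P)=\mathrm{Hom}_{\mathcal F}(P,P)$, and let $\mathrm{Aut}_S(P)$ be the group of the automorphisms $c_g$ of $P$ with $g\in N_S(P)$. The fusion system $\mathcal F$ is saturated if every subgroup of $S$ is isomorphic in $\mathcal F$ to a subgroup $P$ such that (i) $\mathrm{Aut}_S(P)$ is a Sylow $p$-subgroup of $\mathrm{Aut}_{\mathcal F}(P)$, and (ii) every isomorphism $\varphi:Q\to P$ of $\mathcal F$ extends to a morphism $N_\varphi\to S$ of $\mathcal F$, where $N_\varphi=\{g\in N_S(Q) : \varphi c_g\varphi^{-1}\in \mathrm{Aut}_S(P)\}$. Let $\mathcal G$ and $\mathcal F$ be saturated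 fusion systems over $S$ with $\mathcal G\le\mathcal F$, that is, $\mathrm{Hom}_{\mathcal G}(P,Q)\subseteq\mathrm{Hom}_{\mathcal F}(P,Q)$ for all $P,Q\le S$. Suppose that $\mathrm{Hom}_{\mathcal G}(A,B)=\mathrm{Hom}_{\mathcal F}(A,B)$ for all elementary abelian subgroups $A,B\le S$ of rank at least $2$. Then $\mathcal G=\mathcal F$, that is, $\mathrm{Hom}_{\mathcal G}(P,Q)=\mathrm{Hom}_{\mathcal F}(P,Q)$ for all $P,Q\le S$. -/

import Mathlib

/-- The homomorphism `c_g : P → Q`, `x ↦ g x g⁻¹`, for `g` with `g P g⁻¹ ≤ Q`. -/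
def conjHom {S : Type*} [Group S] (g : S) (P Q : Subgroup S)
    (h : ∀ x ∈ P, g * x * g⁻¹ ∈ Q) : P →* Q :=
  ((MulAut.conj g).toMonoidHom.comp P.subtype).codRestrict Q (fun x => h x x.2)

/-- A fusion system over a group `S` (to be used for a finite `p`-group `S`): a category whose
objects are the subgroups of `S`, whose morphisms from `P` to `Q` are injective group homomorphisms
`P → Q` (composed as maps), which contains all the conjugation maps `c_g`, `g ∈ S`, and in which
every morphism is an isomorphism of the category followed by an inclusion. (The identity of `P` is
the conjugation map `c_1`.) -/
@[ext]
structure FusionSystem (S : Type*) [Group S] where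
  /-- The set of morphisms from `P` to `Q`. -/
  Hom : ∀ P Q : Subgroup S, Set (P →* Q)
  comp_mem : ∀ {P Q R : Subgroup S} (ψ : Q →* R) (φ : P →* Q),
    ψ ∈ Hom Q R → φ ∈ Hom P Q → ψ.comp φ ∈ Hom P R
  conjHom_mem : ∀ (g : S) (P Q : Subgroup S) (h : ∀ x ∈ P, g * x * g⁻¹ ∈ Q),
    conjHom g P Q h ∈ Hom P Q
  injective : ∀ {P Q : Subgroup S} (φ : P →* Q), φ ∈ Hom P Q → Function.Injective φ
  factor : ∀ {P Q : Subgroup S} (φ : P →* Q), φ ∈ Hom P Q →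
    ∃ (R : Subgroup S) (hR : R ≤ Q) (ψ : P ≃* R),
      ψ.toMonoidHom ∈ Hom P R ∧ ψ.symm.toMonoidHom ∈ Hom R P ∧
        φ = (Subgroup.inclusion hR).comp ψ.toMonoidHom

namespace FusionSystem

variable {S : Type*} [Group S]

/-- `𝒢 ≤ ℱ`: every morphism of `𝒢` is a morphism of `ℱ`. -/
instance : LE (FusionSystem S) where
  le 𝒢 ℱ := ∀ P Q : Subgroup S, 𝒢.Hom P Q ⊆ ℱ.Hom P Q

/-- `φ` is an isomorphism of the category `ℱ`. -/
def IsIso (ℱ : FusionSystem S) {P Q : Subgroup S} (φ : P ≃* Q) : Prop :=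
  φ.toMonoidHom ∈ ℱ.Hom P Q ∧ φ.symm.toMonoidHom ∈ ℱ.Hom Q P

/-- `P` and `Q` are `ℱ`-conjugate: isomorphic objects of the category `ℱ`. -/
def IsConjugate (ℱ : FusionSystem S) (P Q : Subgroup S) : Prop :=
  ∃ φ : P ≃* Q, ℱ.IsIso φ

theorem id_mem (ℱ : FusionSystem S) (P : Subgroup S) : MonoidHom.id P ∈ ℱ.Hom P P := by
  have h := ℱ.conjHom_mem 1 P P (by simp)
  have e : conjHom 1 P P (by simp) = MonoidHom.id P := by
    ext x
    simp [conjHom]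
  rwa [e] at h

theorem symm_mem (ℱ : FusionSystem S) {P : Subgroup S} (φ : P ≃* P)
    (h : φ.toMonoidHom ∈ ℱ.Hom P P) : φ.symm.toMonoidHom ∈ ℱ.Hom P P := by
  obtain ⟨R, hR, ψ, -, h2, h3⟩ := ℱ.factor _ h
  have hx : ∀ x, φ x = Subgroup.inclusion hR (ψ x) := fun x => DFunLike.congr_fun h3 x
  have hRP : R = P := by
    refine le_antisymm hR fun y hy => ?_
    obtain ⟨x, hxy⟩ := φ.surjective ⟨y, hy⟩
    have : y = (ψ x : S) := by
      have := congrArg Subtype.val ((hx x).symm.trans hxy)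
      simpa using this.symm
    rw [this]
    exact (ψ x).2
  subst hRP
  have : φ = ψ := by
    ext x
    simp [hx x]
  rwa [this]

/-- `Aut_ℱ(P) = Hom_ℱ(P, P)`, as a group of automorphisms of `P`. -/
def autF (ℱ : FusionSystem S) (P : Subgroup S) : Subgroup (MulAut P) where
  carrier := {α | MulEquiv.toMonoidHom α ∈ ℱ.Hom P P}
  mul_mem' {α β} hα hβ := ℱ.comp_mem (MulEquiv.toMonoidHom α) (MulEquiv.toMonoidHom β) hα hβ
  one_mem' := ℱ.id_mem P
  inv_mem' {α} hα := ℱ.symm_mem α hα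

end FusionSystem

/-- `Aut_S(P)`: the automorphisms `c_g` of `P` with `g ∈ N_S(P)`. -/
def autS {S : Type*} [Group S] (P : Subgroup S) : Subgroup (MulAut P) :=
  P.normalizerMonoidHom.range

/-- `N_φ = {g ∈ N_S(Q) | φ ∘ c_g ∘ φ⁻¹ ∈ Aut_S(P)}` for an isomorphism `φ : Q → P`. -/
def extenderSubgroup {S : Type*} [Group S] {Q P : Subgroup S} (φ : Q ≃* P) : Subgroup S :=
  ((autS P).comap ((MulAut.congr φ).toMonoidHom.comp Q.normalizerMonoidHom)).map
    (Subgroup.normalizer (Q : Set S)).subtype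

theorem le_extenderSubgroup {S : Type*} [Group S] {Q P : Subgroup S} (φ : Q ≃* P) :
    Q ≤ extenderSubgroup φ := by
  intro x hx
  refine ⟨⟨x, Subgroup.le_normalizer hx⟩, ?_, rfl⟩
  refine ⟨⟨(φ ⟨x, hx⟩ : S), Subgroup.le_normalizer (φ ⟨x, hx⟩).2⟩, ?_⟩
  ext y
  have h : Q.normalizerMonoidHom ⟨x, Subgroup.le_normalizer hx⟩ (φ.symm y)
      = ⟨x, hx⟩ * φ.symm y * ⟨x, hx⟩⁻¹ := by
    ext
    simp
  simp [h]

namespace FusionSystem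

variable {S : Type*} [Group S]

/-- `P` is fully automised in `ℱ`: `Aut_S(P)` is a Sylow `p`-subgroup of `Aut_ℱ(P)`. -/
def FullyAutomised (ℱ : FusionSystem S) (p : ℕ) (P : Subgroup S) : Prop :=
  ∃ T : Sylow p (ℱ.autF P), (T : Subgroup (ℱ.autF P)) = (autS P).subgroupOf (ℱ.autF P)

/-- `P` is receptive in `ℱ`: every isomorphism `φ : Q → P` of `ℱ` extends to a morphism
`N_φ → S` of `ℱ`. -/
def Receptive (ℱ : FusionSystem S) (P : Subgroup S) : Prop :=
  ∀ (Q : Subgroup S) (φ : Q ≃* P), ℱ.IsIso φ →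
    ∃ ψ ∈ ℱ.Hom (extenderSubgroup φ) ⊤,
      ∀ x : Q, (ψ ⟨x, le_extenderSubgroup φ x.2⟩ : S) = (φ x : S)

/-- `ℱ` is saturated: every subgroup of `S` is `ℱ`-conjugate to a fully automised and receptive
subgroup. -/
def IsSaturated (ℱ : FusionSystem S) (p : ℕ) : Prop :=
  ∀ P : Subgroup S, ∃ Q : Subgroup S,
    ℱ.IsConjugate P Q ∧ ℱ.FullyAutomised p Q ∧ ℱ.Receptive Q

end FusionSystem

/-- `A` is an elementary abelian `p`-group: abelian and killed by `p`. Its rank as a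
vector space over `𝔽_p` is `Group.rank A`, the least number of generators. -/
def IsElementaryAbelian (p : ℕ) (A : Type*) [Group A] : Prop :=
  (∀ x y : A, x * y = y * x) ∧ ∀ x : A, x ^ p = 1

/-!
The argument is a downward induction on the order of `P ≤ S`: suppose that `𝒢` and `ℱ` have the
same morphisms on the subgroups of order greater than `|P|`. Up to `ℱ`-isomorphism `P` is fully
automised and receptive in `ℱ` (an isomorphism from `R` onto `P` can be chosen to extend to
`N_S(R)`, hence to lie in `𝒢` when `R ≠ S`), so it is enough to treat the automorphisms `α` of `P`
in `ℱ`. Such an `α` lies in `𝒢` as soon as it extends in `ℱ` to a larger subgroup, that is, as soon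
as `N_α > P`. If `P` is cyclic, then `P ≠ S` and `Aut(P)` is commutative, so `N_α = N_S(P) > P`.

If `P` is not cyclic, let `E` be maximal among the elementary abelian subgroups of `P` that are
normal in `N_S(P)`. By a lemma of Alperin, valid for `p` odd, `E` contains all the elements of
order `p` of `C_P(E)`. It follows that `E` is not cyclic, and that the automorphisms of `P` which
fix `E` pointwise are `p`-elements, because an automorphism of order prime to `p` which fixes the
elements of order `p` of a `p`-group is trivial. Hence the automorphisms of `P` in `ℱ` that fix
`E` pointwise form a `p`-group normalized by the Sylow subgroup `Aut_S(P)`, so they belong to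
`Aut_S(P)`, and in particular to `𝒢`.

By hypothesis `α` restricted to `E` lies in `𝒢`. Let `θ : N_S(E) → S` be a morphism of `𝒢` that
carries `E` to a fully automised and receptive `𝒢`-conjugate. Then `θα⁻¹`, defined on `α(E)`,
extends to a morphism `ψ : P → S` of `𝒢`, since `α` conjugates the action of `P` on `E` to its
action on `α(E)`. So `γ = ψα` is a morphism of `ℱ` which agrees on `E` with the morphism `θ` of
`𝒢`, and it remains to see that `γ` lies in `𝒢`; this is `FusionSystem.Receptive.mor_of_eqOn`, where
either `θ⁻¹γ` is an automorphism of `P` fixing `E`, or an automorphism of `P` obtained from `γ`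
extends beyond `P`.
-/

open scoped commutatorElement

/-! ### Maximal subgroups and powers in `p`-groups -/

theorem Subgroup.commutatorElement_mem_of_index_prime {G : Type*} [Group G] {p : ℕ} [Fact p.Prime]
    {M : Subgroup G} [M.Normal] (hM : M.index = p) (a b : G) : ⁅a, b⁆ ∈ M := by
  have : IsCyclic (G ⧸ M) := isCyclic_of_prime_card (p := p) hM
  have hc : ∀ x y : G ⧸ M, x * y = y * x := IsMulCommutative.is_comm.comm
  rw [← QuotientGroup.eq_one_iff]
  have : ((⁅a, b⁆ : G) : G ⧸ M) = ⁅(a : G ⧸ M), (b : G ⧸ M)⁆ := rfl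
  rw [this, commutatorElement_eq_one_iff_mul_comm]
  exact hc _ _

namespace IsPGroup

variable {p : ℕ} {P : Type*} [Group P]

theorem eq_one_of_pow_eq_one (hP : IsPGroup p P) {n : ℕ} (hn : p.Coprime n) {x : P}
    (hx : x ^ n = 1) : x = 1 := by
  have h1 := hP.orderOf_coprime hn x
  have h2 := orderOf_dvd_of_pow_eq_one hx
  exact orderOf_eq_one_iff.1 (Nat.eq_one_of_dvd_coprimes h1 dvd_rfl h2)

theorem exists_le_normal_index_eq [Finite P] [hp : Fact p.Prime] (hP : IsPGroup p P)
    {H : Subgroup P} (hH : H ≠ ⊤) : ∃ M : Subgroup P, H ≤ M ∧ M.Normal ∧ M.index = p := by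
  obtain ⟨n, hn⟩ := IsPGroup.iff_card.1 hP
  obtain ⟨m, hm⟩ := IsPGroup.iff_card.1 (hP.to_subgroup H)
  have hlt : p ^ m < p ^ n := by
    rw [← hn, ← hm]
    refine lt_of_le_of_ne (Subgroup.card_le_card_group H) fun h => hH ?_
    exact Subgroup.eq_top_of_card_eq H h
  have hmn : m < n := (Nat.pow_lt_pow_iff_right hp.out.one_lt).1 hlt
  obtain ⟨k, rfl⟩ : ∃ k, n = k + 1 := ⟨n - 1, by omega⟩
  obtain ⟨M, hM, hHM⟩ := Sylow.exists_subgroup_card_pow_prime_le p (n := m) (m := k)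
    (hn ▸ pow_dvd_pow p (Nat.le_succ k)) H hm (by omega)
  have hi : M.index = p := by
    have := M.card_mul_index
    rw [hM, hn, pow_succ] at this
    exact Nat.eq_of_mul_eq_mul_left (pow_pos hp.out.pos k) this
  refine ⟨M, hHM, Subgroup.normal_of_index_eq_minFac_card ?_, hi⟩
  rw [hi, hn, hp.out.pow_minFac (by omega)]

end IsPGroup

theorem pow_mul_of_central_commutator {G : Type*} [Group G] {x y c : G} (h : y * x = x * y * c)
    (hy : Commute c y) (n : ℕ) : y ^ n * x = x * y ^ n * c ^ n := by
  induction n with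
  | zero => simp
  | succ k ih =>
    rw [pow_succ, mul_assoc, h, ← mul_assoc, ← mul_assoc, ih, mul_assoc (x * y ^ k),
      (hy.pow_left k).eq, pow_succ c]
    simp only [mul_assoc]

/-- The power formula in a group of class two, with the central commutator `c` of `x` and `y`. -/
theorem mul_pow_of_central_commutator {G : Type*} [Group G] {x y c : G} (h : y * x = x * y * c)
    (hx : Commute c x) (hy : Commute c y) (n : ℕ) :
    (x * y) ^ n = x ^ n * y ^ n * c ^ n.choose 2 := by
  induction n with
  | zero => simp
  | succ k ih =>
    rw [pow_succ, ih, mul_assoc, ((hx.mul_right hy).pow_left _).eq, ← mul_assoc, ← mul_assoc,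
      mul_assoc (x ^ k), pow_mul_of_central_commutator h hy, ← mul_assoc, ← mul_assoc, ← pow_succ,
      mul_assoc _ (c ^ k) y, (hy.pow_left k).eq, ← mul_assoc, mul_assoc (x ^ (k + 1)), ← pow_succ,
      mul_assoc _ (c ^ k), ← pow_add, Nat.choose_succ_succ' k 1, Nat.choose_one_right]

/-- For `p` odd, taking `p`-th powers is multiplicative on pairs whose commutator is central of
order dividing `p`; this is where `p ≠ 2` enters. -/
theorem mul_pow_prime_of_central_commutator {G : Type*} [Group G] {p : ℕ} (hp : p.Prime)
    (hodd : Odd p) {x y c : G} (h : y * x = x * y * c)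
    (hx : Commute c x) (hy : Commute c y) (hc : c ^ p = 1) :
    (x * y) ^ p = x ^ p * y ^ p := by
  rw [mul_pow_of_central_commutator h hx hy]
  have h2 : p ≠ 2 := by rintro rfl; exact absurd hodd (by decide)
  have : p ∣ p.choose 2 := hp.dvd_choose_self two_ne_zero (lt_of_le_of_ne hp.two_le h2.symm)
  obtain ⟨k, hk⟩ := this
  rw [hk, pow_mul, hc, one_pow, mul_one]

/-! ### Automorphisms of order prime to `p` -/

section Omega

variable {p : ℕ} {P : Type*} [Group P]

/-- A step of coprime action: if `γ` has order prime to `p` and fixes `x⁻¹ γ(x)`, it fixes `x`. -/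
theorem eq_of_fixes_inv_mul (hP : IsPGroup p P) {n : ℕ} (hn : p.Coprime n) (γ : P →* P)
    (hγ : ∀ x, γ^[n] x = x) {x : P} (hx : γ (x⁻¹ * γ x) = x⁻¹ * γ x) : γ x = x := by
  have h : ∀ k, γ^[k] x = x * (x⁻¹ * γ x) ^ k := by
    intro k
    induction k with
    | zero => simp
    | succ k ih =>
      rw [Function.iterate_succ_apply', ih, map_mul, map_pow, hx, pow_succ', ← mul_assoc,
        mul_inv_cancel_left]
  have h1 := h n
  rw [hγ, left_eq_mul] at h1
  have := hP.eq_one_of_pow_eq_one hn h1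
  rw [inv_mul_eq_one] at this
  exact this.symm

/-- For `p` odd, an automorphism of order prime to `p` of a finite `p`-group which fixes all the
elements of order `p` is trivial. In a minimal counterexample `P` every proper invariant subgroup
is fixed pointwise, which forces the Frattini subgroup to be central; then `x ↦ x ^ p` is
multiplicative and every `x⁻¹ γ(x)` has order `p`. -/
theorem eq_of_fixes_pow_prime_eq_one [Finite P] (hp : p.Prime) (hodd : Odd p) (hP : IsPGroup p P)
    {n : ℕ} (hn : p.Coprime n) (γ : P →* P) (hγ : ∀ x, γ^[n] x = x)
    (hfix : ∀ x, x ^ p = 1 → γ x = x) (x : P) : γ x = x := by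
  have : Fact p.Prime := ⟨hp⟩
  induction hN : Nat.card P using Nat.strong_induction_on generalizing P with
  | _ N ih =>
  subst hN
  have hinv : ∀ H : Subgroup P, H ≠ ⊤ → (∀ y ∈ H, γ y ∈ H) → ∀ y ∈ H, γ y = y := by
    intro H hH hHγ y hy
    let δ : H →* H := (γ.comp H.subtype).codRestrict H fun z => hHγ z z.2
    have hδ : ∀ z : H, ((δ^[n] z : H) : P) = γ^[n] z :=
      Function.Semiconj.iterate_right (f := Subtype.val) (fun _ => rfl) n
    have hlt : Nat.card H < Nat.card P :=
      lt_of_le_of_ne (Subgroup.card_le_card_group H) fun h => hH (Subgroup.eq_top_of_card_eq H h)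
    have := ih _ hlt (hP.to_subgroup H) δ (fun z => Subtype.ext (by rw [hδ, hγ]))
      (fun z hz => Subtype.ext (hfix z (by simpa using congrArg Subtype.val hz))) ⟨y, hy⟩ rfl
    exact congrArg Subtype.val this
  by_cases hD : Subgroup.closure (Set.range fun y => y⁻¹ * γ y) = ⊤
  · -- The subgroup `U` generated by commutators and `p`-th powers is invariant and proper.
    let U : Subgroup P := commutator P ⊔ Subgroup.closure (Set.range fun y => y ^ p)
    by_cases hPt : Subsingleton P
    · exact Subsingleton.elim _ _
    rw [not_subsingleton_iff_nontrivial] at hPt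
    obtain ⟨M, -, hMn, hMi⟩ := hP.exists_le_normal_index_eq (H := ⊥) bot_ne_top
    have hUM : U ≤ M := by
      refine sup_le ?_ ?_
      · rw [commutator_def, Subgroup.commutator_le]
        exact fun a _ b _ => Subgroup.commutatorElement_mem_of_index_prime hMi a b
      · rw [Subgroup.closure_le]
        rintro _ ⟨y, rfl⟩
        rw [← hMi]
        exact M.pow_index_mem y
    have hUtop : U ≠ ⊤ := by
      intro h
      rw [h, top_le_iff] at hUM
      rw [hUM, Subgroup.index_top] at hMi
      exact hp.one_lt.ne hMi
    have hUγ : U ≤ U.comap γ := by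
      refine sup_le ?_ ?_
      · rw [commutator_def, Subgroup.commutator_le]
        intro a _ b _
        rw [Subgroup.mem_comap, map_commutatorElement]
        exact Subgroup.mem_sup_left
          (Subgroup.commutator_mem_commutator (Subgroup.mem_top _) (Subgroup.mem_top _))
      · rw [Subgroup.closure_le]
        rintro _ ⟨y, rfl⟩
        rw [SetLike.mem_coe, Subgroup.mem_comap]
        simp only [map_pow]
        exact Subgroup.mem_sup_right (Subgroup.subset_closure ⟨γ y, rfl⟩)
    have hUfix : ∀ y ∈ U, γ y = y := hinv U hUtop hUγ
    have hUn : U.Normal := Subgroup.Normal.of_commutator_le P le_sup_left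
    have hUc : ∀ z ∈ U, ∀ y, Commute z y := by
      intro z hz
      have : Subgroup.closure (Set.range fun y => y⁻¹ * γ y) ≤ Subgroup.centralizer {z} := by
        rw [Subgroup.closure_le]
        rintro _ ⟨y, rfl⟩
        have h1 := hUfix _ (hUn.conj_mem z hz y)
        rw [map_mul, map_mul, map_inv, hUfix z hz] at h1
        rw [SetLike.mem_coe, Subgroup.mem_centralizer_singleton_iff]
        have h2 : γ y * z = y * z * y⁻¹ * γ y := by rw [← h1]; group
        rw [mul_assoc, h2]; group
      rw [hD, top_le_iff] at this
      intro y
      have h3 : y ∈ Subgroup.centralizer {z} := this ▸ Subgroup.mem_top y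
      exact (Subgroup.mem_centralizer_singleton_iff.1 h3).symm
    have hcomm : ∀ a b : P, ⁅a, b⁆ ∈ U := fun a b => Subgroup.mem_sup_left
      (Subgroup.commutator_mem_commutator (Subgroup.mem_top _) (Subgroup.mem_top _))
    have hpow : ∀ a : P, a ^ p ∈ U := fun a =>
      Subgroup.mem_sup_right (Subgroup.subset_closure ⟨a, rfl⟩)
    refine eq_of_fixes_inv_mul hP hn γ hγ (hfix _ ?_)
    set d := x⁻¹ * γ x with hd
    have hxd : γ x = x * d := by rw [hd]; group
    let c : P := ⁅d⁻¹, x⁻¹⁆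
    have hc : d * x = x * d * c := by
      simp only [c, commutatorElement_def]; group
    have hcU : c ∈ U := hcomm _ _
    have hcp : c ^ p = 1 := by
      have h1 := pow_mul_of_central_commutator hc (hUc c hcU d) p
      rw [(hUc _ (hpow d) x).eq, left_eq_mul] at h1
      exact h1
    have h3 := mul_pow_prime_of_central_commutator hp hodd hc (hUc c hcU x) (hUc c hcU d) hcp
    rw [← hxd, ← map_pow, hUfix _ (hpow x), left_eq_mul] at h3
    exact h3
  · refine eq_of_fixes_inv_mul hP hn γ hγ (hinv _ hD ?_ _ (Subgroup.subset_closure ⟨x, rfl⟩))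
    intro y hy
    have : Subgroup.closure (Set.range fun y => y⁻¹ * γ y) ≤
        (Subgroup.closure (Set.range fun y => y⁻¹ * γ y)).comap γ := by
      rw [Subgroup.closure_le]
      rintro _ ⟨z, rfl⟩
      exact Subgroup.subset_closure ⟨γ z, by simp⟩
    exact this hy

end Omega

/-- If `E` is a normal subgroup of the finite `p`-group `P`, `p` odd, containing every element of
order `p` of its centralizer, then the automorphisms of `P` fixing `E` pointwise are
`p`-elements. Indeed one of order prime to `p` fixes `C_P(E)` pointwise, and moves every `x` by an
element of `C_P(E)`. -/
theorem exists_pow_pow_eq_one_of_fixes {p : ℕ} {P : Type*} [Group P] [Finite P] (hp : p.Prime)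
    (hodd : Odd p) (hP : IsPGroup p P) {E : Subgroup P} [hEn : E.Normal]
    (hE : ∀ x, x ^ p = 1 → (∀ e ∈ E, e * x = x * e) → x ∈ E) (α : MulAut P)
    (hα : ∀ e ∈ E, α e = e) : ∃ k : ℕ, α ^ p ^ k = 1 := by
  have : Fact p.Prime := ⟨hp⟩
  have : Finite (MulAut P) :=
    Finite.of_injective (fun f : MulAut P => (f : P → P)) DFunLike.coe_injective
  obtain ⟨k, n, hn, hkn⟩ := Nat.exists_eq_pow_mul_and_not_dvd (orderOf_pos α).ne' p hp.ne_one
  rw [← Nat.Prime.coprime_iff_not_dvd hp] at hn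
  refine ⟨k, ?_⟩
  set β := α ^ p ^ k with hβ
  have hβn : β ^ n = 1 := by rw [hβ, ← pow_mul, ← hkn, pow_orderOf_eq_one]
  have hfixpow : ∀ j, ∀ e ∈ E, (α ^ j) e = e := by
    intro j e he
    induction j with
    | zero => rfl
    | succ j ih => rw [pow_succ, MulAut.mul_apply, hα e he, ih]
  have hβE : ∀ e ∈ E, β e = e := hfixpow _
  let γ : P →* P := β.toMonoidHom
  have hγ : ∀ x, γ^[n] x = x := by
    intro x
    have h1 : ∀ j, ∀ x, γ^[j] x = (β ^ j) x := by
      intro j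
      induction j with
      | zero => intro x; rfl
      | succ j ih => intro x; rw [Function.iterate_succ_apply, ih, pow_succ, MulAut.mul_apply]; rfl
    rw [h1, hβn]
    rfl
  let C := Subgroup.centralizer (E : Set P)
  have hC : ∀ x, x ∈ C ↔ ∀ e ∈ E, e * x = x * e := fun x => Subgroup.mem_centralizer_iff
  have hCγ : ∀ x ∈ C, γ x ∈ C := by
    intro x hx
    rw [hC] at hx ⊢
    intro e he
    have := congrArg γ (hx e he)
    rw [map_mul, map_mul] at this
    rwa [show γ e = e from hβE e he] at this
  have hCfix : ∀ x ∈ C, γ x = x := by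
    intro x hx
    let δ : C →* C := (γ.comp C.subtype).codRestrict C fun z => hCγ z z.2
    have hδ : ∀ z : C, ((δ^[n] z : C) : P) = γ^[n] z :=
      Function.Semiconj.iterate_right (f := Subtype.val) (fun _ => rfl) n
    refine congrArg Subtype.val (eq_of_fixes_pow_prime_eq_one hp hodd (hP.to_subgroup C) hn δ
      (fun z => Subtype.ext (by rw [hδ, hγ])) (fun z hz => Subtype.ext ?_) ⟨x, hx⟩)
    exact hβE _ (hE z (by simpa using congrArg Subtype.val hz) ((hC _).1 z.2))
  ext x
  refine eq_of_fixes_inv_mul hP hn γ hγ (hCfix _ ((hC _).2 fun e he => ?_))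
  have h1 := hβE _ (hEn.conj_mem e he x)
  rw [map_mul, map_mul, map_inv, hβE e he] at h1
  have h2 : γ x * e = x * e * x⁻¹ * γ x := by
    rw [← h1]
    simp [γ]
  rw [mul_assoc, h2]
  group

/-! ### A criterion for cyclicity -/

/-- A finite `p`-group, `p` odd, with at most `p` solutions of `x ^ p = 1` is cyclic. In a minimal
counterexample there are two cyclic maximal subgroups; they meet in a central subgroup containing
all `p`-th powers, so that `x ↦ x ^ p` is a homomorphism with image and kernel too small. -/
theorem IsPGroup.isCyclic_of_card_pow_eq_one_le {p : ℕ} {P : Type*} [Group P] [Finite P]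
    (hp : p.Prime) (hodd : Odd p) (hP : IsPGroup p P)
    (hcard : Nat.card {x : P // x ^ p = 1} ≤ p) : IsCyclic P := by
  have : Fact p.Prime := ⟨hp⟩
  induction hN : Nat.card P using Nat.strong_induction_on generalizing P with
  | _ N ih =>
  subst hN
  by_contra hcyc
  have hlt : ∀ H : Subgroup P, H ≠ ⊤ → Nat.card H < Nat.card P := fun H hH =>
    lt_of_le_of_ne (Subgroup.card_le_card_group H) fun h => hH (Subgroup.eq_top_of_card_eq H h)
  have hsub : ∀ H : Subgroup P, H ≠ ⊤ → ∀ x ∈ H, ∀ y ∈ H, x * y = y * x := by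
    intro H hH x hx y hy
    have : IsCyclic H := by
      refine ih _ (hlt H hH) (hP.to_subgroup H) (le_trans ?_ hcard) rfl
      refine Nat.card_le_card_of_injective
        (fun x : {x : H // x ^ p = 1} => (⟨x.1, by simpa using congrArg Subtype.val x.2⟩ :
          {x : P // x ^ p = 1})) fun x y h => ?_
      exact Subtype.ext (Subtype.ext (Subtype.mk.inj h))
    have h := (IsMulCommutative.is_comm (M := H)).comm ⟨x, hx⟩ ⟨y, hy⟩
    exact congrArg Subtype.val h
  have hz : ∀ a : P, Subgroup.zpowers a ≠ ⊤ := fun a ha =>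
    hcyc ⟨a, (Subgroup.eq_top_iff' _).1 ha⟩
  have htop : ∀ M : Subgroup P, M.index = p → M ≠ ⊤ := by
    rintro M hM rfl
    rw [Subgroup.index_top] at hM
    exact hp.one_lt.ne hM
  obtain ⟨M, -, hMn, hMi⟩ := hP.exists_le_normal_index_eq (hz 1)
  obtain ⟨a, ha⟩ : ∃ a, a ∉ M := by
    by_contra! h
    exact htop M hMi ((Subgroup.eq_top_iff' M).2 h)
  obtain ⟨N, haN, hNn, hNi⟩ := hP.exists_le_normal_index_eq (hz a)
  replace haN : a ∈ N := haN (Subgroup.mem_zpowers a)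
  have hsup : M ⊔ N = ⊤ := by
    by_contra h
    have h1 := hlt _ h
    have h2 : Nat.card M < Nat.card (M ⊔ N : Subgroup P) := by
      refine lt_of_le_of_ne (Subgroup.card_le_of_le le_sup_left) fun h3 => ha ?_
      rw [Subgroup.eq_of_le_of_card_ge le_sup_left h3.ge]
      exact Subgroup.mem_sup_right haN
    have h3 := M.index_dvd_of_le (le_sup_left : M ≤ M ⊔ N)
    have h4 := (M ⊔ N).card_mul_index
    have h5 := M.card_mul_index
    rw [hMi] at h3 h5
    rcases (Nat.dvd_prime hp).1 h3 with h6 | h6 <;> rw [h6] at h4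
    · omega
    · have := Nat.eq_of_mul_eq_mul_right hp.pos (h4.trans h5.symm)
      omega
  have hcentral : ∀ z ∈ M ⊓ N, ∀ y, Commute z y := by
    intro z hz y
    have : M ⊔ N ≤ Subgroup.centralizer {z} := by
      refine sup_le (fun x hx => ?_) fun x hx => ?_
      · exact Subgroup.mem_centralizer_singleton_iff.2 (hsub M (htop M hMi) x hx z hz.1)
      · exact Subgroup.mem_centralizer_singleton_iff.2 (hsub N (htop N hNi) x hx z hz.2)
    exact (Subgroup.mem_centralizer_singleton_iff.1 (this (hsup ▸ Subgroup.mem_top y))).symm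
  have hpow : ∀ x : P, x ^ p ∈ M ⊓ N := fun x =>
    ⟨by simpa [hMi] using M.pow_index_mem x, by simpa [hNi] using N.pow_index_mem x⟩
  have hmul : ∀ x y : P, (x * y) ^ p = x ^ p * y ^ p := by
    intro x y
    have hcomm : ⁅y⁻¹, x⁻¹⁆ ∈ M ⊓ N :=
      ⟨Subgroup.commutatorElement_mem_of_index_prime hMi _ _,
        Subgroup.commutatorElement_mem_of_index_prime hNi _ _⟩
    have hc : y * x = x * y * ⁅y⁻¹, x⁻¹⁆ := by
      simp only [commutatorElement_def]; group
    refine mul_pow_prime_of_central_commutator hp hodd hc (hcentral _ hcomm x)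
      (hcentral _ hcomm y) ?_
    have h1 := pow_mul_of_central_commutator hc (hcentral _ hcomm y) p
    rw [(hcentral _ (hpow y) x).eq, left_eq_mul] at h1
    exact h1
  let f : P →* (M ⊓ N : Subgroup P) :=
    MonoidHom.mk' (fun x => ⟨x ^ p, hpow x⟩) fun x y => Subtype.ext (hmul x y)
  have hker : Nat.card f.ker ≤ p := by
    refine le_trans (Nat.card_le_card_of_injective (fun x : f.ker => (⟨x.1, ?_⟩ :
      {x : P // x ^ p = 1})) fun x y h => ?_) hcard
    · exact congrArg Subtype.val (MonoidHom.mem_ker.1 x.2)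
    · exact Subtype.ext (Subtype.mk.inj h)
  have hrange : Nat.card f.range ≤ Nat.card (M ⊓ N : Subgroup P) := Subgroup.card_le_card_group _
  have h1 := f.ker.card_mul_index
  rw [Subgroup.index_ker] at h1
  have h2 : Nat.card (M ⊓ N : Subgroup P) < Nat.card M := by
    refine lt_of_le_of_ne (Subgroup.card_le_of_le inf_le_left) fun h3 => ?_
    have h4 : M ≤ N := inf_eq_left.1 (Subgroup.eq_of_le_of_card_ge inf_le_left h3.ge)
    rw [sup_eq_right.2 h4] at hsup
    exact htop N hNi hsup
  have h3 := M.card_mul_index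
  rw [hMi, ← h1] at h3
  have h4 : Nat.card f.ker * Nat.card f.range ≤ p * Nat.card (M ⊓ N : Subgroup P) :=
    Nat.mul_le_mul hker hrange
  rw [← h3, mul_comm] at h4
  exact absurd (Nat.le_of_mul_le_mul_left h4 hp.pos) (not_le.2 h2)

/-! ### Self-centralizing elementary abelian subgroups -/

section SelfCentralizing

variable {T : Type*} [Group T]

/-- A step of Alperin's lemma: let `E` be central in `C` and contain all the elements of order `p`
of `C ∩ Z_i`, with `Z_i` the upper central series. If `x ∈ C ∩ Z_{i+1}` and `y ∈ C` have order `p`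
and `y ≡ x` modulo `Z_i`, then `y ≡ x` modulo `E`. The proof replaces `y` by `y x y⁻¹`, which
agrees with `x` one step further down in the lower central series. -/
theorem mul_inv_mem_of_mem_upperCentralSeries [Group.IsNilpotent T] {p : ℕ} (hp : p.Prime)
    (hodd : Odd p) {C E : Subgroup T} (hcomm : ∀ e ∈ E, ∀ x ∈ C, Commute e x)
    (hexp : ∀ e ∈ E, e ^ p = 1) {i : ℕ}
    (hi : ∀ u ∈ C, u ∈ Subgroup.upperCentralSeries T i → u ^ p = 1 → u ∈ E) {x : T} (hxC : x ∈ C)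
    (hx : x ∈ Subgroup.upperCentralSeries T (i + 1)) (hxp : x ^ p = 1) {y : T} (hyC : y ∈ C)
    (hyp : y ^ p = 1) (hyx : y * x⁻¹ ∈ Subgroup.upperCentralSeries T i) : y * x⁻¹ ∈ E := by
  obtain ⟨n, hn⟩ := Subgroup.nilpotent_iff_lowerCentralSeries.1 ‹Group.IsNilpotent T›
  have key : ∀ m k : ℕ, n ≤ k + m → ∀ y ∈ C, y ^ p = 1 →
      y * x⁻¹ ∈ Subgroup.upperCentralSeries T i →
      y * x⁻¹ ∈ (⊤ : Subgroup T).lowerCentralSeries k → y * x⁻¹ ∈ E := by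
    intro m
    induction m with
    | zero =>
      intro k hk y _ _ _ h
      have := Subgroup.lowerCentralSeries_antitone ⊤ hk h
      rw [hn, Subgroup.mem_bot] at this
      rw [this]
      exact one_mem E
    | succ m ih =>
      intro k hk y hyC hyp hyi hyk
      have h1 : y * x * y⁻¹ * x⁻¹ ∈ E := by
        refine ih (k + 1) (by omega) _ (mul_mem (mul_mem hyC hxC) (inv_mem hyC)) ?_ ?_ ?_
        · rw [conj_pow, hxp]; simp
        · have := inv_mem (Subgroup.mem_upperCentralSeries_succ_iff.1 hx y)
          rwa [commutatorElement_inv] at this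
        · rw [Subgroup.lowerCentralSeries_succ]
          have := Subgroup.commutator_mem_commutator hyk (Subgroup.mem_top x)
          convert! this using 1
          simp only [commutatorElement_def]
          group
      refine hi _ (mul_mem hyC (inv_mem hxC)) hyi ?_
      have h2 : x⁻¹ * y = y * x⁻¹ * (y * x * y⁻¹ * x⁻¹) := by
        rw [((hcomm _ h1 y hyC).mul_right (hcomm _ h1 x⁻¹ (inv_mem hxC))).eq.symm]
        calc x⁻¹ * y = x⁻¹ * (y * x * y⁻¹ * x⁻¹) * (x * y * x⁻¹) := by group
          _ = y * x * y⁻¹ * x⁻¹ * (y * x⁻¹) := by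
            rw [← (hcomm _ h1 x⁻¹ (inv_mem hxC)).eq]; group
      rw [mul_pow_prime_of_central_commutator hp hodd h2 (hcomm _ h1 y hyC)
        (hcomm _ h1 _ (inv_mem hxC)) (hexp _ h1), hyp, inv_pow, hxp]
      simp
  exact key n 0 (by omega) y hyC hyp hyx (by simp)

/-- **Alperin's lemma**, relative to a normal subgroup `P`: for `p` odd, a maximal member `E` of
the elementary abelian subgroups of `P` that are normal in the `p`-group `T` contains every element
of order `p` of `P` that centralizes it. -/
theorem exists_normal_elementaryAbelian [Finite T] {p : ℕ} (hp : p.Prime) (hodd : Odd p)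
    (hT : IsPGroup p T) (P : Subgroup T) [hPn : P.Normal] :
    ∃ E ≤ P, E.Normal ∧ (∀ x ∈ E, ∀ y ∈ E, x * y = y * x) ∧ (∀ x ∈ E, x ^ p = 1) ∧
      ∀ x ∈ P, x ^ p = 1 → (∀ e ∈ E, e * x = x * e) → x ∈ E := by
  have : Fact p.Prime := ⟨hp⟩
  have : Group.IsNilpotent T := hT.isNilpotent
  let A : Set (Subgroup T) := {E | E ≤ P ∧ E.Normal ∧ (∀ x ∈ E, ∀ y ∈ E, x * y = y * x) ∧
    ∀ x ∈ E, x ^ p = 1}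
  have hA : A.Nonempty := by
    refine ⟨⊥, bot_le, inferInstance, ?_, ?_⟩
    · intro x hx y hy
      rw [Subgroup.mem_bot] at hx hy
      rw [hx, hy]
    · intro x hx
      rw [Subgroup.mem_bot] at hx
      rw [hx, one_pow]
  obtain ⟨E, hE⟩ := A.toFinite.exists_maximal hA
  obtain ⟨⟨hEP, hEn, hEc, hEp⟩, hmax⟩ := hE
  refine ⟨E, hEP, hEn, hEc, hEp, ?_⟩
  let C := P ⊓ Subgroup.centralizer (E : Set T)
  have hC : ∀ x, x ∈ C ↔ x ∈ P ∧ ∀ e ∈ E, e * x = x * e := fun x =>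
    Subgroup.mem_inf.trans (and_congr_right fun _ => Subgroup.mem_centralizer_iff)
  have hEC : E ≤ C := fun e he => (hC e).2 ⟨hEP he, fun f hf => hEc f hf e he⟩
  have hcomm : ∀ e ∈ E, ∀ x ∈ C, Commute e x := fun e he x hx => ((hC x).1 hx).2 e he
  have key : ∀ i, ∀ u ∈ C, u ∈ Subgroup.upperCentralSeries T i → u ^ p = 1 → u ∈ E := by
    intro i
    induction i with
    | zero =>
      intro u _ hu _
      rw [Subgroup.upperCentralSeries_zero, Subgroup.mem_bot] at hu
      rw [hu]
      exact one_mem E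
    | succ i ih =>
      intro x hxC hx hxp
      -- By the previous lemma `x` is central modulo `E`, so `⟨E, x⟩` belongs to the family `A`.
      have hconj : ∀ g, g * x * g⁻¹ * x⁻¹ ∈ E := by
        intro g
        refine mul_inv_mem_of_mem_upperCentralSeries hp hodd hcomm hEp ih hxC hx hxp ?_ ?_ ?_
        · rw [hC] at hxC ⊢
          refine ⟨hPn.conj_mem x hxC.1 g, fun e he => ?_⟩
          have := hxC.2 _ (hEn.conj_mem' e he g)
          calc e * (g * x * g⁻¹) = g * (g⁻¹ * e * g * x) * g⁻¹ := by group
            _ = g * x * g⁻¹ * e := by rw [this]; group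
        · rw [conj_pow, hxp]; simp
        · have := inv_mem (Subgroup.mem_upperCentralSeries_succ_iff.1 hx g)
          rwa [commutatorElement_inv] at this
      have hD : E ⊔ Subgroup.zpowers x ∈ A := by
        have hmem : ∀ d, d ∈ E ⊔ Subgroup.zpowers x ↔ ∃ e ∈ E, ∃ k : ℤ, e * x ^ k = d := by
          intro d
          rw [Subgroup.mem_sup_of_normal_left]
          constructor
          · rintro ⟨e, he, _, ⟨k, rfl⟩, rfl⟩
            exact ⟨e, he, k, rfl⟩
          · rintro ⟨e, he, k, rfl⟩
            exact ⟨e, he, _, ⟨k, rfl⟩, rfl⟩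
        refine ⟨sup_le hEP ?_, ⟨?_⟩, ?_, ?_⟩
        · rw [Subgroup.zpowers_le]
          exact ((hC x).1 hxC).1
        · intro d hd g
          obtain ⟨e, he, k, rfl⟩ := (hmem d).1 hd
          have h1 : g * x * g⁻¹ ∈ E ⊔ Subgroup.zpowers x := by
            have := mul_mem (Subgroup.mem_sup_left (hconj g) : _ ∈ E ⊔ Subgroup.zpowers x)
              (Subgroup.mem_sup_right (Subgroup.mem_zpowers x))
            simpa using this
          have h2 : g * (e * x ^ k) * g⁻¹ = g * e * g⁻¹ * (g * x * g⁻¹) ^ k := by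
            rw [conj_zpow]; group
          rw [h2]
          exact mul_mem (Subgroup.mem_sup_left (hEn.conj_mem e he g)) (zpow_mem h1 k)
        · intro d hd d' hd'
          obtain ⟨e, he, k, rfl⟩ := (hmem d).1 hd
          obtain ⟨e', he', k', rfl⟩ := (hmem d').1 hd'
          have h1 : Commute e e' := hEc e he e' he'
          have h2 : Commute e x := hcomm e he x hxC
          have h3 : Commute e' x := hcomm e' he' x hxC
          exact ((h1.mul_right (h2.zpow_right k')).mul_left
            ((h3.symm.zpow_left k).mul_right (Commute.zpow_zpow_self x k k'))).eq
        · intro d hd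
          obtain ⟨e, he, k, rfl⟩ := (hmem d).1 hd
          rw [((hcomm e he x hxC).zpow_right k).mul_pow, hEp e he, ← zpow_natCast, ← zpow_mul,
            mul_comm, zpow_mul, zpow_natCast, hxp]
          simp
      exact hmax hD le_sup_left (Subgroup.mem_sup_right (Subgroup.mem_zpowers x))
  intro x hxP hxp hxE
  obtain ⟨n, hn⟩ := ‹Group.IsNilpotent T›
  exact key n x ((hC x).2 ⟨hxP, hxE⟩) (hn ▸ Subgroup.mem_top x) hxp

end SelfCentralizing

theorem isCyclic_of_rank_le_one {G : Type*} [Group G] [Finite G] (h : Group.rank G ≤ 1) :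
    IsCyclic G := by
  obtain ⟨s, hs, hst⟩ := Group.rank_spec G
  rw [← hs, Finset.card_le_one_iff_subset_singleton] at h
  obtain ⟨g, hg⟩ := h
  refine ⟨g, fun x => ?_⟩
  have : Subgroup.closure (s : Set G) ≤ Subgroup.zpowers g := by
    rw [Subgroup.closure_le]
    intro y hy
    rw [Finset.mem_singleton.1 (hg hy)]
    exact Subgroup.mem_zpowers g
  exact this (hst ▸ Subgroup.mem_top x)

/-- A normal subgroup of prime order of a nilpotent group is central. -/
theorem Subgroup.commute_of_normal_of_card_eq_prime {G : Type*} [Group G] [Group.IsNilpotent G]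
    {p : ℕ} (hp : p.Prime) {E : Subgroup G} [hE : E.Normal] (hcard : Nat.card E = p) {e : G}
    (he : e ∈ E) (x : G) : e * x = x * e := by
  by_contra hne
  have hu : ⁅e, x⁆ ≠ 1 := fun h => hne (commutatorElement_eq_one_iff_mul_comm.1 h)
  have huE : ⁅e, x⁆ ∈ E := by
    have := mul_mem he (hE.conj_mem _ (inv_mem he) x)
    convert! this using 1
    simp only [commutatorElement_def]; group
  have hgen : E ≤ Subgroup.zpowers ⁅e, x⁆ := by
    have : Fact p.Prime := ⟨hp⟩
    intro y hy
    obtain ⟨k, hk⟩ := mem_zpowers_of_prime_card hcard (g := ⟨⁅e, x⁆, huE⟩) (g' := ⟨y, hy⟩)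
      fun h => hu (congrArg Subtype.val h)
    exact ⟨k, congrArg Subtype.val hk⟩
  have key : ∀ n, E ≤ (⊤ : Subgroup G).lowerCentralSeries n := by
    intro n
    induction n with
    | zero => simp
    | succ n ih =>
      refine hgen.trans (Subgroup.zpowers_le.2 ?_)
      rw [Subgroup.lowerCentralSeries_succ]
      exact Subgroup.commutator_mem_commutator (ih he) (Subgroup.mem_top x)
  obtain ⟨n, hn⟩ := Subgroup.nilpotent_iff_lowerCentralSeries.1 ‹Group.IsNilpotent G›
  have := key n huE
  rw [hn, Subgroup.mem_bot] at this
  exact hu this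

/-- The elementary abelian subgroup on which the whole proof turns: it is normalized by `N_S(P)`,
has rank at least two, and detects the automorphisms of `P` of order prime to `p`. -/
theorem exists_elementaryAbelian_detecting {p : ℕ} {S : Type*} [Group S] [Finite S] (hp : p.Prime)
    (hodd : Odd p) (hS : IsPGroup p S) {P : Subgroup S} (hP : ¬ IsCyclic P) :
    ∃ E ≤ P, (∀ g ∈ Subgroup.normalizer (P : Set S), ∀ e ∈ E, g * e * g⁻¹ ∈ E) ∧
      IsElementaryAbelian p E ∧ 2 ≤ Group.rank E ∧
      ∀ α : MulAut P, (∀ x : P, (x : S) ∈ E → α x = x) → ∃ k : ℕ, α ^ p ^ k = 1 := by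
  have : Fact p.Prime := ⟨hp⟩
  have hT := hS.to_subgroup (Subgroup.normalizer (P : Set S))
  obtain ⟨E, hEP, hEn, hEc, hEp, hmax⟩ := exists_normal_elementaryAbelian hp hodd hT
    (P.subgroupOf (Subgroup.normalizer (P : Set S)))
  have hmem : ∀ x : S, x ∈ E.map (Subgroup.normalizer (P : Set S)).subtype ↔
      ∃ h : x ∈ Subgroup.normalizer (P : Set S), ⟨x, h⟩ ∈ E := by
    intro x
    constructor
    · rintro ⟨y, hy, rfl⟩
      exact ⟨y.2, hy⟩
    · rintro ⟨h, hx⟩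
      exact ⟨_, hx, rfl⟩
  have hle : E.map (Subgroup.normalizer (P : Set S)).subtype ≤ P := by
    rintro x ⟨y, hy, rfl⟩
    exact hEP hy
  set F := E.map (Subgroup.normalizer (P : Set S)).subtype with hF
  have hFn : ∀ g ∈ Subgroup.normalizer (P : Set S), ∀ e ∈ F, g * e * g⁻¹ ∈ F := by
    intro g hg e he
    obtain ⟨h, he⟩ := (hmem e).1 he
    exact ⟨_, hEn.conj_mem _ he ⟨g, hg⟩, rfl⟩
  have hFc : ∀ x ∈ F, ∀ y ∈ F, x * y = y * x := by
    rintro _ ⟨x, hx, rfl⟩ _ ⟨y, hy, rfl⟩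
    exact congrArg Subtype.val (hEc x hx y hy)
  have hFp : ∀ x ∈ F, x ^ p = 1 := by
    rintro _ ⟨x, hx, rfl⟩
    exact congrArg Subtype.val (hEp x hx)
  have hFmax : ∀ x ∈ P, x ^ p = 1 → (∀ e ∈ F, e * x = x * e) → x ∈ F := by
    intro x hx hxp hxe
    exact ⟨⟨x, Subgroup.le_normalizer hx⟩, hmax _ hx (Subtype.ext hxp)
      (fun e he => Subtype.ext (hxe _ ⟨e, he, rfl⟩)), rfl⟩
  have hPn : (F.subgroupOf P).Normal :=
    ⟨fun e he g => hFn g (Subgroup.le_normalizer g.2) e he⟩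
  refine ⟨F, hle, hFn, ⟨fun x y => Subtype.ext (hFc x x.2 y y.2),
    fun x => Subtype.ext (hFp x x.2)⟩, ?_, ?_⟩
  · -- If `F` is cyclic, it has order at most `p`, so is central in `P`, and contains every element
    -- of order `p` of `P`: then `P` is cyclic.
    by_contra hr
    have hc : IsCyclic F := isCyclic_of_rank_le_one (by omega)
    obtain ⟨g, hg⟩ := hc.exists_generator
    have hcard : Nat.card F ∣ p := by
      rw [← orderOf_eq_card_of_forall_mem_zpowers hg]
      exact orderOf_dvd_of_pow_eq_one (Subtype.ext (hFp g g.2))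
    have hcard' : Nat.card (F.subgroupOf P) = Nat.card F :=
      Nat.card_congr (Subgroup.subgroupOfEquivOfLe hle).toEquiv
    have hcent : ∀ e ∈ F, ∀ x ∈ P, e * x = x * e := by
      intro e he x hx
      rcases (Nat.dvd_prime hp).1 hcard with h1 | h1
      · have : e = 1 := by
          rw [Subgroup.card_eq_one] at h1
          rwa [h1, Subgroup.mem_bot] at he
        rw [this, one_mul, mul_one]
      · have : Group.IsNilpotent P := (hS.to_subgroup P).isNilpotent
        exact congrArg Subtype.val (Subgroup.commute_of_normal_of_card_eq_prime hp
          (E := F.subgroupOf P) (hcard'.trans h1) (e := ⟨e, hle he⟩) he ⟨x, hx⟩)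
    refine hP ((hS.to_subgroup P).isCyclic_of_card_pow_eq_one_le hp hodd
      (le_trans ?_ (Nat.le_of_dvd hp.pos hcard)))
    refine Nat.card_le_card_of_injective (fun x : {x : P // x ^ p = 1} => (⟨x.1, ?_⟩ : F))
      fun x y h => Subtype.ext (Subtype.ext (Subtype.mk.inj h))
    exact hFmax x.1 x.1.2 (by simpa using congrArg Subtype.val x.2)
      fun e he => hcent e he _ x.1.2
  · intro α hα
    refine exists_pow_pow_eq_one_of_fixes hp hodd (hS.to_subgroup P) (E := F.subgroupOf P) ?_ α hα
    intro x hxp hxe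
    exact hFmax x x.2 (by simpa using congrArg Subtype.val hxp)
      fun e he => congrArg Subtype.val (hxe ⟨e, hle he⟩ he)

/-! ### Morphisms of a fusion system as functions on `S` -/

namespace FusionSystem

variable {S : Type*} [Group S] {ℱ : FusionSystem S}

/-- `f` restricts on `P` to a morphism of `ℱ`. Only the values of `f` on `P` matter; working with
total functions `S → S` makes restriction of morphisms invisible and composition that of functions.
-/
def Mor (ℱ : FusionSystem S) (P : Subgroup S) (f : S → S) : Prop :=
  ∃ φ ∈ ℱ.Hom P ⊤, ∀ x : P, (φ x : S) = f x

theorem inclusion_mem (ℱ : FusionSystem S) {P Q : Subgroup S} (h : P ≤ Q) :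
    Subgroup.inclusion h ∈ ℱ.Hom P Q := by
  have h1 := ℱ.conjHom_mem 1 P Q (by simpa using fun x hx => h hx)
  convert! h1 using 1
  ext x
  simp [conjHom]

theorem mem_hom_of_coe_eq {P Q R : Subgroup S} {φ : P →* Q} {ψ : P →* R}
    (hφ : φ ∈ ℱ.Hom P Q) (h : ∀ x, (ψ x : S) = φ x) : ψ ∈ ℱ.Hom P R := by
  obtain ⟨A, hA, e, he, -, rfl⟩ := ℱ.factor φ hφ
  have hAR : A ≤ R := by
    intro y hy
    have := h (e.symm ⟨y, hy⟩)
    simp only [MonoidHom.comp_apply, MulEquiv.toMonoidHom_eq_coe, MonoidHom.coe_coe,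
      MulEquiv.apply_symm_apply, Subgroup.coe_inclusion] at this
    rw [← this]
    exact (ψ _).2
  have : ψ = (Subgroup.inclusion hAR).comp e.toMonoidHom := by
    ext x
    rw [h]
    simp
  rw [this]
  exact ℱ.comp_mem _ _ (ℱ.inclusion_mem hAR) he

theorem mor_iff {P Q : Subgroup S} {f : S → S} {φ : P →* Q} (h : ∀ x : P, (φ x : S) = f x) :
    ℱ.Mor P f ↔ φ ∈ ℱ.Hom P Q := by
  constructor
  · rintro ⟨ψ, hψ, hf⟩
    exact mem_hom_of_coe_eq hψ fun x => by rw [h, hf]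
  · intro hφ
    exact ⟨(Subgroup.inclusion le_top).comp φ, ℱ.comp_mem _ _ (ℱ.inclusion_mem le_top) hφ,
      fun x => by rw [← h]; simp⟩

/-- Two fusion systems with the same morphisms in the sense of `Mor` coincide. -/
theorem eq_of_mor_iff {𝒢 : FusionSystem S} (h : ∀ P f, 𝒢.Mor P f ↔ ℱ.Mor P f) : 𝒢 = ℱ := by
  classical
  refine FusionSystem.ext (funext fun P => funext fun Q => Set.ext fun φ => ?_)
  let f : S → S := fun y => if hy : y ∈ P then (φ ⟨y, hy⟩ : S) else 1
  have hφ : ∀ x : P, (φ x : S) = f x := fun x => by simp [f]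
  rw [← mor_iff hφ, ← mor_iff hφ, h]

theorem mem_of_image_eq {P Q : Subgroup S} {f : S → S} (h : f '' P = Q) {x : S} (hx : x ∈ P) :
    f x ∈ Q := by
  rw [← SetLike.mem_coe, ← h]
  exact ⟨x, hx, rfl⟩

namespace Mor

variable {P Q : Subgroup S} {f g : S → S}

theorem congr (hf : ℱ.Mor P f) (h : ∀ x ∈ P, f x = g x) : ℱ.Mor P g := by
  obtain ⟨φ, hφ, hf⟩ := hf
  exact ⟨φ, hφ, fun x => by rw [hf, h x x.2]⟩

theorem mono (hf : ℱ.Mor P f) (h : Q ≤ P) : ℱ.Mor Q f := by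
  obtain ⟨φ, hφ, hf⟩ := hf
  exact ⟨φ.comp (Subgroup.inclusion h), ℱ.comp_mem _ _ hφ (ℱ.inclusion_mem h),
    fun x => by simp [hf]⟩

theorem map_mul (hf : ℱ.Mor P f) {x y : S} (hx : x ∈ P) (hy : y ∈ P) : f (x * y) = f x * f y := by
  obtain ⟨φ, -, hf⟩ := hf
  have := congrArg Subtype.val (_root_.map_mul φ ⟨x, hx⟩ ⟨y, hy⟩)
  rw [Subgroup.coe_mul, hf, hf, hf] at this
  exact this

theorem map_one (hf : ℱ.Mor P f) : f 1 = 1 := by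
  have := hf.map_mul P.one_mem P.one_mem
  rwa [one_mul, left_eq_mul] at this

theorem map_inv (hf : ℱ.Mor P f) {x : S} (hx : x ∈ P) : f x⁻¹ = (f x)⁻¹ := by
  rw [eq_inv_iff_mul_eq_one, ← hf.map_mul (inv_mem hx) hx, inv_mul_cancel, hf.map_one]

theorem map_conj (hf : ℱ.Mor P f) {g x : S} (hg : g ∈ P) (hx : x ∈ P) :
    f (g * x * g⁻¹) = f g * f x * (f g)⁻¹ := by
  rw [hf.map_mul (mul_mem hg hx) (inv_mem hg), hf.map_mul hg hx, hf.map_inv hg]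

theorem injOn (hf : ℱ.Mor P f) : Set.InjOn f P := by
  obtain ⟨φ, hφ, hf⟩ := hf
  intro x hx y hy h
  have := ℱ.injective φ hφ (a₁ := ⟨x, hx⟩) (a₂ := ⟨y, hy⟩) (Subtype.ext (by rw [hf, hf]; exact h))
  exact congrArg Subtype.val this

/-- The image of a subgroup under a morphism. -/
def image (hf : ℱ.Mor P f) : Subgroup S where
  carrier := f '' P
  mul_mem' := by
    rintro _ _ ⟨x, hx, rfl⟩ ⟨y, hy, rfl⟩
    exact ⟨x * y, mul_mem hx hy, hf.map_mul hx hy⟩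
  one_mem' := ⟨1, P.one_mem, hf.map_one⟩
  inv_mem' := by
    rintro _ ⟨x, hx, rfl⟩
    exact ⟨x⁻¹, inv_mem hx, hf.map_inv hx⟩

theorem coe_image (hf : ℱ.Mor P f) : (hf.image : Set S) = f '' P := rfl

theorem card_eq (hf : ℱ.Mor P f) (h : f '' P = Q) : Nat.card Q = Nat.card P := by
  rw [← SetLike.coe_sort_coe, ← h]
  exact Nat.card_image_of_injOn hf.injOn

theorem comp (hg : ℱ.Mor Q g) (hf : ℱ.Mor P f) (h : ∀ x ∈ P, f x ∈ Q) : ℱ.Mor P (g ∘ f) := by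
  obtain ⟨ψ, hψ, hg⟩ := hg
  obtain ⟨φ, hφ, hf⟩ := hf
  let φ' : P →* Q := (Subgroup.subtype ⊤ |>.comp φ).codRestrict Q fun x => by
    simpa [hf] using h x x.2
  have hφ' : φ' ∈ ℱ.Hom P Q := mem_hom_of_coe_eq hφ fun x => rfl
  exact ⟨ψ.comp φ', ℱ.comp_mem _ _ hψ hφ', fun x => by
    have : (φ' x : S) = f x := hf x
    rw [MonoidHom.comp_apply, hg, this]
    rfl⟩

theorem exists_mulEquiv (hf : ℱ.Mor P f) (h : f '' P = Q) :
    ∃ e : P ≃* Q, ℱ.IsIso e ∧ ∀ x, (e x : S) = f x := by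
  obtain ⟨φ, hφ, hf⟩ := hf
  obtain ⟨A, hA, e, he, he', rfl⟩ := ℱ.factor φ hφ
  have hef : ∀ x : P, (e x : S) = f x := fun x => by rw [← hf]; simp
  have hAQ : A = Q := by
    apply SetLike.coe_injective
    rw [← h]
    ext y
    constructor
    · intro hy
      exact ⟨e.symm ⟨y, hy⟩, (e.symm ⟨y, hy⟩).2, by rw [← hef]; simp⟩
    · rintro ⟨x, hx, rfl⟩
      rw [← hef ⟨x, hx⟩]
      exact (e ⟨x, hx⟩).2
  subst hAQ
  exact ⟨e, ⟨he, he'⟩, hef⟩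

/-- A morphism has an inverse on its image. -/
theorem exists_inverse (hf : ℱ.Mor P f) (h : f '' P = Q) :
    ∃ g, ℱ.Mor Q g ∧ g '' Q = P ∧ (∀ x ∈ P, g (f x) = x) ∧ ∀ y ∈ Q, f (g y) = y := by
  classical
  obtain ⟨e, he, hef⟩ := hf.exists_mulEquiv h
  have hfQ : ∀ x ∈ P, f x ∈ Q := fun x => mem_of_image_eq h
  let g : S → S := fun y => if hy : y ∈ Q then (e.symm ⟨y, hy⟩ : S) else 1
  have hg : ∀ y : Q, (e.symm y : S) = g y := fun y => by simp [g]
  have hgf : ∀ x ∈ P, g (f x) = x := by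
    intro x hx
    have h1 : (⟨f x, hfQ x hx⟩ : Q) = e ⟨x, hx⟩ := Subtype.ext (hef ⟨x, hx⟩).symm
    rw [← hg ⟨f x, hfQ x hx⟩, h1, e.symm_apply_apply]
  refine ⟨g, (mor_iff (φ := e.symm.toMonoidHom) hg).2 he.2, ?_, hgf, ?_⟩
  · rw [← h]
    ext x
    constructor
    · rintro ⟨_, ⟨x, hx, rfl⟩, rfl⟩
      rwa [hgf x hx]
    · exact fun hx => ⟨f x, ⟨x, hx, rfl⟩, hgf x hx⟩
  · intro y hy
    rw [← hg ⟨y, hy⟩, ← hef, e.apply_symm_apply]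

end Mor

theorem mor_conj (ℱ : FusionSystem S) (P : Subgroup S) (g : S) : ℱ.Mor P fun x => g * x * g⁻¹ :=
  ⟨_, ℱ.conjHom_mem g P ⊤ fun _ _ => Subgroup.mem_top _, fun _ => rfl⟩

theorem IsConjugate.exists_mor {P Q : Subgroup S} (h : ℱ.IsConjugate P Q) :
    ∃ f, ℱ.Mor P f ∧ f '' P = Q := by
  classical
  obtain ⟨e, he⟩ := h
  let f : S → S := fun y => if hy : y ∈ P then (e ⟨y, hy⟩ : S) else 1
  have hf : ∀ x : P, (e x : S) = f x := fun x => by simp [f]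
  refine ⟨f, (mor_iff (φ := e.toMonoidHom) hf).2 he.1, ?_⟩
  ext y
  constructor
  · rintro ⟨x, hx, rfl⟩
    rw [← hf ⟨x, hx⟩]
    exact (e _).2
  · intro hy
    exact ⟨e.symm ⟨y, hy⟩, (e.symm _).2, by rw [← hf, e.apply_symm_apply]⟩

theorem mem_autS {P : Subgroup S} {α : MulAut P} :
    α ∈ autS P ↔ ∃ h ∈ Subgroup.normalizer (P : Set S), ∀ x : P, (α x : S) = h * x * h⁻¹ := by
  constructor
  · rintro ⟨h, rfl⟩
    exact ⟨h, h.2, fun x => rfl⟩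
  · rintro ⟨h, hh, hα⟩
    exact ⟨⟨h, hh⟩, by ext x; rw [hα]; rfl⟩

theorem mem_extenderSubgroup {P Q : Subgroup S} {e : Q ≃* P} {g : S} :
    g ∈ extenderSubgroup e ↔ g ∈ Subgroup.normalizer (Q : Set S) ∧
      ∃ h ∈ Subgroup.normalizer (P : Set S), ∀ x y : Q, (y : S) = g * x * g⁻¹ →
        (e y : S) = h * e x * h⁻¹ := by
  constructor
  · rintro ⟨g, hg, rfl⟩
    obtain ⟨h, hh, H⟩ := mem_autS.1 (Subgroup.mem_comap.1 hg)
    refine ⟨g.2, h, hh, fun x y hxy => ?_⟩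
    have := H (e x)
    rw [← this]
    have hy : y = Q.normalizerMonoidHom g x := Subtype.ext hxy
    rw [hy]
    simp
  · rintro ⟨hg, h, hh, H⟩
    refine ⟨⟨g, hg⟩, Subgroup.mem_comap.2 (mem_autS.2 ⟨h, hh, fun x => ?_⟩), rfl⟩
    have := H (e.symm x) (Q.normalizerMonoidHom ⟨g, hg⟩ (e.symm x)) rfl
    rwa [e.apply_symm_apply] at this

end FusionSystem

/-! ### Normalizers in `p`-groups -/

theorem Subgroup.mem_normalizer_of_conj_mem {G : Type*} [Group G] [Finite G] {P : Subgroup G}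
    {g : G} (h : ∀ x ∈ P, g * x * g⁻¹ ∈ P) : g ∈ Subgroup.normalizer (P : Set G) :=
  Subgroup.mem_normalizer_fintype h

theorem Subgroup.card_lt_card_of_mem_of_notMem {G : Type*} [Group G] [Finite G] {P N : Subgroup G}
    (hPN : P ≤ N) {c : G} (hc : c ∈ N) (hcP : c ∉ P) : Nat.card P < Nat.card N := by
  refine lt_of_le_of_ne (Subgroup.card_le_of_le hPN) fun h => hcP ?_
  rwa [Subgroup.eq_of_le_of_card_ge hPN h.ge]

/-- In a finite `p`-group, a subgroup `C` normalized by `P` but not contained in it has an element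
outside `P` normalizing `P`. -/
theorem IsPGroup.exists_mem_normalizer_notMem {p : ℕ} {S : Type*} [Group S] [Finite S]
    [Fact p.Prime] (hS : IsPGroup p S) {P C : Subgroup S}
    (hPC : P ≤ Subgroup.normalizer (C : Set S)) (hC : ¬ C ≤ P) :
    ∃ c ∈ C, c ∈ Subgroup.normalizer (P : Set S) ∧ c ∉ P := by
  have hne : P.subgroupOf (P ⊔ C) ≠ ⊤ := fun h =>
    hC (le_sup_right.trans (Subgroup.subgroupOf_eq_top.1 h))
  have : Group.IsNilpotent (P ⊔ C : Subgroup S) := (hS.to_subgroup _).isNilpotent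
  obtain ⟨g, hgn, hgP⟩ := SetLike.exists_of_lt
    (Group.normalizerCondition_of_isNilpotent _ hne.lt_top)
  have hg : (g : S) ∈ ((P ⊔ C : Subgroup S) : Set S) := g.2
  rw [Subgroup.coe_mul_of_left_le_normalizer_right P C hPC] at hg
  obtain ⟨q, hq, c, hc, hqc⟩ := hg
  replace hqc : q * c = g := hqc
  have hgS : (g : S) ∈ Subgroup.normalizer (P : Set S) := by
    refine Subgroup.mem_normalizer_of_conj_mem fun x hx => ?_
    exact (Subgroup.mem_normalizer_iff.1 hgn ⟨x, Subgroup.mem_sup_left hx⟩).1 hx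
  have hcg : c = q⁻¹ * g := by rw [← hqc, inv_mul_cancel_left]
  refine ⟨c, hc, ?_, fun hcP => hgP ?_⟩
  · rw [hcg]
    exact mul_mem (inv_mem (Subgroup.le_normalizer hq)) hgS
  · rw [Subgroup.mem_subgroupOf, ← hqc]
    exact mul_mem hq hcP

theorem IsPGroup.exists_mem_normalizer_notMem_of_ne_top {p : ℕ} {S : Type*} [Group S] [Finite S]
    [Fact p.Prime] (hS : IsPGroup p S) {P : Subgroup S} (hP : P ≠ ⊤) :
    ∃ c ∈ Subgroup.normalizer (P : Set S), c ∉ P := by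
  have : Group.IsNilpotent S := hS.isNilpotent
  exact SetLike.exists_of_lt (Group.normalizerCondition_of_isNilpotent P hP.lt_top)

/-! ### Receptive and fully automised subgroups -/

namespace FusionSystem
variable {S : Type*} [Group S] {ℱ : FusionSystem S} {P Q : Subgroup S} {f : S → S}

theorem Mor.map_mem_normalizer [Finite S] {R : Subgroup S} (hf : ℱ.Mor R f) (hPR : P ≤ R)
    (h : f '' P = Q) {u : S} (huR : u ∈ R) (hu : ∀ x ∈ P, u * x * u⁻¹ ∈ P) :
    f u ∈ Subgroup.normalizer (Q : Set S) := by
  refine Subgroup.mem_normalizer_of_conj_mem fun y hy => ?_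
  rw [← SetLike.mem_coe, ← h] at hy ⊢
  obtain ⟨x, hx, rfl⟩ := hy
  exact ⟨u * x * u⁻¹, hu x hx, hf.map_conj huR (hPR hx)⟩

theorem exists_mor_of_mem_autF {α : MulAut P} (hα : α ∈ ℱ.autF P) :
    ∃ f, ℱ.Mor P f ∧ f '' P = P ∧ ∀ x : P, f x = α x := by
  classical
  let f : S → S := fun y => if hy : y ∈ P then (α ⟨y, hy⟩ : S) else 1
  have hf : ∀ x : P, (α x : S) = f x := fun x => by simp [f]
  refine ⟨f, (mor_iff (φ := MulEquiv.toMonoidHom α) hf).2 hα, ?_, fun x => (hf x).symm⟩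
  ext y
  constructor
  · rintro ⟨x, hx, rfl⟩
    rw [← hf ⟨x, hx⟩]
    exact (α _).2
  · intro hy
    exact ⟨α.symm ⟨y, hy⟩, (α.symm _).2, by rw [← hf, MulEquiv.apply_symm_apply]⟩

theorem Mor.exists_mem_autF (hf : ℱ.Mor P f) (h : f '' P = P) :
    ∃ α ∈ ℱ.autF P, ∀ x : P, (α x : S) = f x := by
  obtain ⟨e, he, hef⟩ := hf.exists_mulEquiv h
  exact ⟨e, he.1, hef⟩

/-- The extension property of a receptive subgroup, in terms of `Mor`. -/
theorem Receptive.exists_extension (hP : ℱ.Receptive P) (hf : ℱ.Mor Q f) (h : f '' Q = P) :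
    ∃ (N : Subgroup S) (f' : S → S), ℱ.Mor N f' ∧ Q ≤ N ∧ (∀ x ∈ Q, f' x = f x) ∧
      ∀ g ∈ Subgroup.normalizer (Q : Set S), ∀ k ∈ Subgroup.normalizer (P : Set S),
        (∀ x ∈ Q, f (g * x * g⁻¹) = k * f x * k⁻¹) → g ∈ N := by
  classical
  obtain ⟨e, he, hef⟩ := hf.exists_mulEquiv h
  obtain ⟨ψ, hψ, hψe⟩ := hP Q e he
  let f' : S → S := fun y => if hy : y ∈ extenderSubgroup e then (ψ ⟨y, hy⟩ : S) else 1
  have hf' : ∀ x : extenderSubgroup e, (ψ x : S) = f' x := fun x => by simp [f']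
  refine ⟨extenderSubgroup e, f', ⟨ψ, hψ, hf'⟩, le_extenderSubgroup e, fun x hx => ?_, ?_⟩
  · rw [← hf' ⟨x, le_extenderSubgroup e hx⟩, hψe ⟨x, hx⟩, hef]
  · intro g hg k hk H
    refine mem_extenderSubgroup.2 ⟨hg, k, hk, fun x y hxy => ?_⟩
    rw [hef, hef, hxy, H x x.2]

variable {p : ℕ}

/-- If `Q` is fully automised, then any isomorphism `P → Q` can be modified by an automorphism of
`Q` so as to carry `Aut_S(P)` into `Aut_S(Q)`. -/
theorem FullyAutomised.exists_conj [Finite S] [Fact p.Prime] (hS : IsPGroup p S)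
    (hQ : ℱ.FullyAutomised p Q) (hf : ℱ.Mor P f) (h : f '' P = Q) :
    ∃ χ, ℱ.Mor Q χ ∧ χ '' Q = Q ∧ ∀ g ∈ Subgroup.normalizer (P : Set S),
      ∃ k ∈ Subgroup.normalizer (Q : Set S), ∀ x ∈ P, χ (f (g * x * g⁻¹)) = k * χ (f x) * k⁻¹ := by
  obtain ⟨e, he, hef⟩ := hf.exists_mulEquiv h
  obtain ⟨T, hT⟩ := hQ
  let A : Subgroup (MulAut Q) := (autS P).map (MulAut.congr e).toMonoidHom
  have hA : IsPGroup p A :=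
    (((hS.to_subgroup _).of_surjective _ P.normalizerMonoidHom.rangeRestrict_surjective).map _)
  have hAF : A ≤ ℱ.autF Q := by
    rintro _ ⟨_, ⟨g, rfl⟩, rfl⟩
    have h1 : MulEquiv.toMonoidHom (P.normalizerMonoidHom g) ∈ ℱ.Hom P P :=
      mem_hom_of_coe_eq (ℱ.conjHom_mem g P P fun x hx => (Subgroup.mem_normalizer_iff.1 g.2 x).1 hx)
        fun x => rfl
    have h2 := ℱ.comp_mem _ _ he.1 (ℱ.comp_mem _ _ h1 he.2)
    exact h2
  have hA' : IsPGroup p (A.subgroupOf (ℱ.autF Q)) :=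
    hA.of_equiv (Subgroup.subgroupOfEquivOfLe hAF).symm
  have : Finite (MulAut Q) :=
    Finite.of_injective (fun f : MulAut Q => (f : Q → Q)) DFunLike.coe_injective
  obtain ⟨R, hR⟩ := hA'.exists_le_sylow
  obtain ⟨χ, hχ⟩ := MulAction.exists_smul_eq (ℱ.autF Q) R T
  obtain ⟨c, hc, hcQ, hcχ⟩ := exists_mor_of_mem_autF χ.2
  refine ⟨c, hc, hcQ, fun g hg => ?_⟩
  let a : MulAut Q := MulAut.congr e (P.normalizerMonoidHom ⟨g, hg⟩)
  have haA : a ∈ A := ⟨_, ⟨⟨g, hg⟩, rfl⟩, rfl⟩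
  have haR : (⟨a, hAF haA⟩ : ℱ.autF Q) ∈ R := hR haA
  have haT : χ * ⟨a, hAF haA⟩ * χ⁻¹ ∈ (T : Subgroup (ℱ.autF Q)) := by
    rw [← hχ, Sylow.smul_def]
    exact ⟨_, haR, rfl⟩
  rw [hT, Subgroup.mem_subgroupOf] at haT
  obtain ⟨k, hk, H⟩ := mem_autS.1 haT
  refine ⟨k, hk, fun x hx => ?_⟩
  have h1 := H (χ.1 (e ⟨x, hx⟩))
  have h2 : ((χ * ⟨a, hAF haA⟩ * χ⁻¹ : ℱ.autF Q) : MulAut Q) (χ.1 (e ⟨x, hx⟩)) =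
      χ.1 (e (P.normalizerMonoidHom ⟨g, hg⟩ ⟨x, hx⟩)) := by
    simp [a]
  rw [h2, ← hcχ, ← hcχ, hef, hef] at h1
  exact h1

/-- If `Q` is fully automised and receptive, then every subgroup `P` isomorphic to it has an
isomorphism onto `Q` that extends to `N_S(P)`. -/
theorem Receptive.exists_mor_normalizer [Finite S] [Fact p.Prime] (hS : IsPGroup p S)
    (hQr : ℱ.Receptive Q) (hQ : ℱ.FullyAutomised p Q) (hf : ℱ.Mor P f) (h : f '' P = Q) :
    ∃ g, ℱ.Mor (Subgroup.normalizer (P : Set S)) g ∧ g '' P = Q := by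
  obtain ⟨χ, hχ, hχQ, H⟩ := hQ.exists_conj hS hf h
  have himg : (χ ∘ f) '' P = Q := by rw [Set.image_comp, h, hχQ]
  obtain ⟨N, g, hg, hPN, hgf, hN⟩ :=
    hQr.exists_extension (hχ.comp hf fun x => mem_of_image_eq h) himg
  refine ⟨g, hg.mono fun u hu => ?_, ?_⟩
  · obtain ⟨k, hk, H⟩ := H u hu
    exact hN u hu k hk H
  · rw [← himg]
    exact Set.image_congr hgf

/-- If `P` is fully automised and `E` is normalized by `N_S(P)` and detects the automorphisms
of `P` of order prime to `p`, then the automorphisms of `P` fixing `E` pointwise are induced by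
`N_S(P)`: they form a `p`-group normalized by the Sylow subgroup `Aut_S(P)`. -/
theorem FullyAutomised.eq_conj_of_fixes [Finite S] (hP : ℱ.FullyAutomised p P) {E : Subgroup S}
    (hEn : ∀ g ∈ Subgroup.normalizer (P : Set S), ∀ e ∈ E, g * e * g⁻¹ ∈ E)
    (hE : ∀ α : MulAut P, (∀ x : P, (x : S) ∈ E → α x = x) → ∃ k : ℕ, α ^ p ^ k = 1)
    (hf : ℱ.Mor P f) (hfP : f '' P = P) (hfE : ∀ e ∈ E, f e = e) :
    ∃ k ∈ Subgroup.normalizer (P : Set S), ∀ x ∈ P, f x = k * x * k⁻¹ := by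
  obtain ⟨T, hT⟩ := hP
  let C : Subgroup (ℱ.autF P) :=
    { carrier := {α | ∀ x : P, (x : S) ∈ E → α.1 x = x}
      one_mem' := fun x _ => rfl
      mul_mem' := by
        intro α β hα hβ x hx
        rw [Subgroup.coe_mul, MulAut.mul_apply, hβ x hx, hα x hx]
      inv_mem' := by
        intro α hα x hx
        rw [Subgroup.coe_inv]
        nth_rw 1 [← hα x hx]
        exact MulAut.inv_apply_self _ _ _ }
  have hC : IsPGroup p C := by
    rw [isPGroup_iff_pow_pow_eq_one]
    intro α
    obtain ⟨k, hk⟩ := hE α.1.1 α.2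
    exact ⟨k, Subtype.ext (Subtype.ext hk)⟩
  have hTC : (T : Subgroup (ℱ.autF P)) ≤ Subgroup.normalizer (C : Set (ℱ.autF P)) := by
    have : Finite (MulAut P) :=
      Finite.of_injective (fun f : MulAut P => (f : P → P)) DFunLike.coe_injective
    intro t ht
    rw [hT, Subgroup.mem_subgroupOf] at ht
    obtain ⟨k, hk, H⟩ := mem_autS.1 (inv_mem ht)
    refine Subgroup.mem_normalizer_of_conj_mem fun α hα x hx => ?_
    have h1 : ((t.1⁻¹ x : P) : S) ∈ E := by rw [H]; exact hEn k hk x hx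
    have h2 := hα _ h1
    rw [Subgroup.coe_mul, Subgroup.coe_mul, Subgroup.coe_inv, MulAut.mul_apply, MulAut.mul_apply,
      h2, MulAut.apply_inv_self]
  have hsup := T.is_maximal' (T.2.to_sup_of_normal_right' hC hTC) le_sup_left
  obtain ⟨α, hα, hαf⟩ := hf.exists_mem_autF hfP
  have hαT : (⟨α, hα⟩ : ℱ.autF P) ∈ (T : Subgroup (ℱ.autF P)) := by
    have : C ≤ T := le_sup_right.trans hsup.le
    exact this fun x hx => Subtype.ext ((hαf x).trans (hfE x hx))
  rw [hT, Subgroup.mem_subgroupOf] at hαT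
  obtain ⟨k, hk, H⟩ := mem_autS.1 hαT
  exact ⟨k, hk, fun x hx => by rw [← H ⟨x, hx⟩, hαf]⟩

end FusionSystem

/-! ### Detection on elementary abelian subgroups -/

namespace FusionSystem

variable {S : Type*} [Group S] {𝒢 ℱ : FusionSystem S} {P : Subgroup S} {f : S → S} {p : ℕ}

/-- Let `ℱ` and `𝒢` agree on the subgroups of larger order than the receptive subgroup `P`. Then an
automorphism `f` of `P` in `ℱ` for which `N_f` is larger than `P` belongs to `𝒢`. -/
theorem Receptive.mor_of_conj_eq [Finite S] (hPr : ℱ.Receptive P)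
    (ih : ∀ (R : Subgroup S) f, Nat.card P < Nat.card R → ℱ.Mor R f → 𝒢.Mor R f)
    (hf : ℱ.Mor P f) (hfP : f '' P = P) {c k : S}
    (hc : c ∈ Subgroup.normalizer (P : Set S)) (hcP : c ∉ P)
    (hk : k ∈ Subgroup.normalizer (P : Set S))
    (h : ∀ x ∈ P, f (c * x * c⁻¹) = k * f x * k⁻¹) : 𝒢.Mor P f := by
  obtain ⟨N, f', hf', hPN, hff', hN⟩ := hPr.exists_extension hf hfP
  have hcard : Nat.card P < Nat.card N :=
    Subgroup.card_lt_card_of_mem_of_notMem hPN (hN c hc k hk h) hcP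
  exact ((ih N f' hcard hf').mono hPN).congr hff'

/-- Automorphisms of a proper cyclic subgroup extend to its normalizer, since `Aut(P)` is
commutative. -/
theorem Receptive.mor_of_isCyclic [Finite S] [Fact p.Prime] (hS : IsPGroup p S)
    (hPr : ℱ.Receptive P)
    (ih : ∀ (R : Subgroup S) f, Nat.card P < Nat.card R → ℱ.Mor R f → 𝒢.Mor R f)
    (hcyc : IsCyclic P) (hP : P ≠ ⊤) (hf : ℱ.Mor P f) (hfP : f '' P = P) : 𝒢.Mor P f := by
  obtain ⟨c, hc, hcP⟩ := hS.exists_mem_normalizer_notMem_of_ne_top hP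
  refine hPr.mor_of_conj_eq ih hf hfP hc hcP hc fun x hx => ?_
  obtain ⟨α, -, hα⟩ := hf.exists_mem_autF hfP
  have hcomm : α * P.normalizerMonoidHom ⟨c, hc⟩ = P.normalizerMonoidHom ⟨c, hc⟩ * α := by
    apply (IsCyclic.mulAutMulEquiv P).injective
    rw [_root_.map_mul, _root_.map_mul, mul_comm]
  have := congrArg Subtype.val (DFunLike.congr_fun hcomm ⟨x, hx⟩)
  rw [MulAut.mul_apply, MulAut.mul_apply, hα] at this
  rw [← hα ⟨x, hx⟩]
  exact this

/-- A map that becomes a morphism of `𝒢` after composition with a morphism of `𝒢` is itself one. -/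
theorem mor_of_comp_mor {Q : Subgroup S} {g : S → S}
    (hfQ : ∀ x ∈ P, f x ∈ Q) (hg : 𝒢.Mor Q g) (hgf : 𝒢.Mor P (g ∘ f)) : 𝒢.Mor P f := by
  obtain ⟨g', hg', -, hgg', -⟩ := hg.exists_inverse hg.coe_image.symm
  exact (hg'.comp hgf fun x hx => ⟨f x, hfQ x hx, rfl⟩).congr fun x hx => hgg' _ (hfQ x hx)

/-- Let `E ≤ P` be normalized by `N_S(P)` and detect the automorphisms of `P` of order prime to
`p`. A morphism `γ` of `ℱ` on `P` that agrees on `E` with a morphism `θ` of `𝒢` defined on `P`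
belongs to `𝒢`.

If `C_S(θ(E)) ≤ γ(P)` then `γ(P) = θ(P)`, and `θ⁻¹γ` fixes `E` pointwise, hence is conjugation by
an element of `N_S(P)`. Otherwise some `c ∈ C_S(θ(E))` normalizes `γ(P)` and lies outside it. As
`P` is fully automised and receptive, there is `η : N_S(γ(P)) → S` in `ℱ`, hence in `𝒢`, with
`η(γ(P)) = P`; conjugating `c_{η(c)}` by the automorphism `ηγ` of `P` gives one fixing `E`, hence
in `Aut_S(P)`, so that `(ηγ)⁻¹` extends beyond `P`. -/
theorem Receptive.mor_of_eqOn [Finite S] [Fact p.Prime] (hS : IsPGroup p S)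
    (hPr : ℱ.Receptive P) (hPa : ℱ.FullyAutomised p P)
    (hle : ∀ (R : Subgroup S) f, 𝒢.Mor R f → ℱ.Mor R f)
    (ih : ∀ (R : Subgroup S) f, Nat.card P < Nat.card R → ℱ.Mor R f → 𝒢.Mor R f)
    {E : Subgroup S} (hEP : E ≤ P)
    (hEn : ∀ g ∈ Subgroup.normalizer (P : Set S), ∀ e ∈ E, g * e * g⁻¹ ∈ E)
    (hE : ∀ α : MulAut P, (∀ x : P, (x : S) ∈ E → α x = x) → ∃ k : ℕ, α ^ p ^ k = 1)
    {γ θ : S → S} (hγ : ℱ.Mor P γ) (hθ : 𝒢.Mor P θ) (hγθ : ∀ e ∈ E, γ e = θ e) :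
    𝒢.Mor P γ := by
  have hEconj : ∀ x ∈ P, ∀ e ∈ E, x * e * x⁻¹ ∈ E := fun x hx =>
    hEn x (Subgroup.le_normalizer hx)
  -- An automorphism fixing `E` pointwise is induced by `N_S(P)`.
  have hfix : ∀ δ, ℱ.Mor P δ → δ '' P = P → (∀ e ∈ E, δ e = e) →
      ∃ k ∈ Subgroup.normalizer (P : Set S), ∀ x ∈ P, δ x = k * x * k⁻¹ := fun δ hδ hδP hδE =>
    hPa.eq_conj_of_fixes hEn hE hδ hδP hδE
  let Q := hγ.image
  have hγQ : ∀ x ∈ P, γ x ∈ Q := fun x hx => ⟨x, hx, rfl⟩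
  have hcard : Nat.card Q = Nat.card P := hγ.card_eq rfl
  let E' := (hγ.mono hEP).image
  let C := Subgroup.centralizer (E' : Set S)
  have hC : ∀ c, c ∈ C ↔ ∀ e ∈ E, γ e * c = c * γ e := by
    intro c
    rw [Subgroup.mem_centralizer_iff]
    exact ⟨fun h e he => h _ ⟨e, he, rfl⟩, by rintro h _ ⟨e, he, rfl⟩; exact h e he⟩
  by_cases hCQ : C ≤ Q
  · have hθQ : ∀ x ∈ P, θ x ∈ Q := by
      intro x hx
      have h1 : (γ x)⁻¹ * θ x ∈ C := by
        rw [hC]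
        intro e he
        have h2 := hγθ _ (hEconj x hx e he)
        rw [hγ.map_conj hx (hEP he), hθ.map_conj hx (hEP he), ← hγθ e he] at h2
        calc γ e * ((γ x)⁻¹ * θ x) = (γ x)⁻¹ * (γ x * γ e * (γ x)⁻¹) * θ x := by group
          _ = (γ x)⁻¹ * θ x * γ e := by rw [h2]; group
      simpa using mul_mem (hγQ x hx) (hCQ h1)
    have hθP : θ '' P = Q := by
      have h1 : hθ.image = Q := Subgroup.eq_of_le_of_card_ge
        (by rintro _ ⟨x, hx, rfl⟩; exact hθQ x hx) (by rw [hcard, hθ.card_eq hθ.coe_image.symm])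
      exact congrArg SetLike.coe h1
    obtain ⟨θ', hθ', hθ'Q, hθ'θ, hθθ'⟩ := hθ.exists_inverse hθP
    obtain ⟨k, hk, hkδ⟩ := hfix (θ' ∘ γ) ((hle _ _ hθ').comp hγ hγQ)
      (by rw [Set.image_comp]; exact hθ'Q)
      (fun e he => by rw [Function.comp_apply, hγθ e he, hθ'θ e (hEP he)])
    exact mor_of_comp_mor hγQ hθ' ((𝒢.mor_conj P k).congr fun x hx => (hkδ x hx).symm)
  · have hQC : Q ≤ Subgroup.normalizer (C : Set S) := by
      rintro _ ⟨x, hx, rfl⟩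
      refine Subgroup.mem_normalizer_of_conj_mem fun c hc => ?_
      rw [hC] at hc ⊢
      intro e he
      have h1 := hc _ (hEconj x⁻¹ (inv_mem hx) e he)
      rw [hγ.map_conj (inv_mem hx) (hEP he), hγ.map_inv hx, inv_inv] at h1
      calc γ e * (γ x * c * (γ x)⁻¹) = γ x * ((γ x)⁻¹ * γ e * γ x * c) * (γ x)⁻¹ := by group
        _ = γ x * c * (γ x)⁻¹ * γ e := by rw [h1]; group
    obtain ⟨c, hcC, hcn, hcQ⟩ := hS.exists_mem_normalizer_notMem hQC hCQ
    obtain ⟨γ', hγ', hγ'Q, -, -⟩ := hγ.exists_inverse (Q := Q) rfl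
    obtain ⟨η, hη, hηQ⟩ := hPr.exists_mor_normalizer hS hPa hγ' hγ'Q
    have hlt : Nat.card P < Nat.card (Subgroup.normalizer (Q : Set S)) := by
      rw [← hcard]
      exact Subgroup.card_lt_card_of_mem_of_notMem Subgroup.le_normalizer hcn hcQ
    have hηG := (ih _ _ hlt hη).mono Subgroup.le_normalizer
    refine mor_of_comp_mor hγQ hηG ?_
    have hb : ℱ.Mor P (η ∘ γ) := (hle _ _ hηG).comp hγ hγQ
    have hbP : (η ∘ γ) '' P = P := by rw [Set.image_comp]; exact hηQ
    obtain ⟨b', hb', hb'P, hb'b, hbb'⟩ := hb.exists_inverse hbP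
    have hd : η c ∈ Subgroup.normalizer (P : Set S) :=
      hη.map_mem_normalizer Subgroup.le_normalizer hηQ hcn
        fun x hx => (Subgroup.mem_normalizer_iff.1 hcn x).1 hx
    have hdP : η c ∉ P := by
      intro h1
      rw [← SetLike.mem_coe, ← hηQ] at h1
      obtain ⟨y, hy, hyc⟩ := h1
      exact hcQ (hη.injOn (Subgroup.le_normalizer hy) hcn hyc ▸ hy)
    have hdconj : ∀ x ∈ P, η c * x * (η c)⁻¹ ∈ P := fun x hx =>
      (Subgroup.mem_normalizer_iff.1 hd x).1 hx
    have hbmem : ∀ x ∈ P, (η ∘ γ) x ∈ P := fun x => mem_of_image_eq hbP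
    have hb'mem : ∀ x ∈ P, b' x ∈ P := fun x => mem_of_image_eq hb'P
    -- `(ηγ)⁻¹ c_{η(c)} (ηγ)` fixes `E` pointwise, since `c` centralizes `γ(E)`.
    obtain ⟨k, hk, hkδ⟩ := hfix (b' ∘ (fun x => η c * x * (η c)⁻¹) ∘ η ∘ γ)
      (hb'.comp ((ℱ.mor_conj P (η c)).comp hb hbmem) fun x hx => hdconj _ (hbmem x hx))
      (by
        rw [Set.image_comp, Set.image_comp, hbP]
        have : (fun x => η c * x * (η c)⁻¹) '' P = P :=
          Subgroup.mem_normalizer_iff_conj_image_eq.1 hd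
        rw [this, hb'P])
      (fun e he => by
        have h1 : γ e * c = c * γ e := (hC c).1 hcC e he
        have h2 : c * γ e * c⁻¹ = γ e := by rw [← h1]; group
        have h3 := hη.map_conj hcn (Subgroup.le_normalizer (hγQ e (hEP he)))
        rw [h2] at h3
        have h4 := hb'b e (hEP he)
        rw [Function.comp_apply] at h4
        simp only [Function.comp_apply]
        rw [← h3, h4])
    have hb'G : 𝒢.Mor P b' := by
      refine hPr.mor_of_conj_eq ih hb' hb'P hd hdP hk fun x hx => ?_
      have := hkδ (b' x) (hb'mem x hx)
      have h5 := hbb' x hx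
      simp only [Function.comp_apply] at this h5
      rwa [h5] at this
    exact mor_of_comp_mor hbmem hb'G
      ((𝒢.mor_conj P 1).congr fun x hx => by simpa using (hb'b x hx).symm)

/-- The automorphisms of a fully automised and receptive noncyclic subgroup `P`. Restricted to the
elementary abelian subgroup `E` of `exists_elementaryAbelian_detecting`, an automorphism `f` of
`P` belongs to `𝒢`; comparing `E` and `f(E)` with a fully automised, receptive `𝒢`-conjugate of `E`,
the saturation of `𝒢` yields morphisms `θ`, `ψ` of `𝒢` on `P` such that `ψf` and `θ` agree on
`E`. -/
theorem Receptive.mor_of_not_isCyclic [Finite S] (hp : p.Prime) (hodd : Odd p) (hS : IsPGroup p S)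
    (h𝒢 : 𝒢.IsSaturated p)
    (hle : ∀ (R : Subgroup S) f, 𝒢.Mor R f → ℱ.Mor R f)
    (hab : ∀ (A : Subgroup S) f,
      IsElementaryAbelian p A → 2 ≤ Group.rank A → ℱ.Mor A f → 𝒢.Mor A f)
    (hPr : ℱ.Receptive P) (hPa : ℱ.FullyAutomised p P)
    (ih : ∀ (R : Subgroup S) f, Nat.card P < Nat.card R → ℱ.Mor R f → 𝒢.Mor R f)
    (hcyc : ¬ IsCyclic P) (hf : ℱ.Mor P f) (hfP : f '' P = P) : 𝒢.Mor P f := by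
  have : Fact p.Prime := ⟨hp⟩
  obtain ⟨E, hEP, hEn, hEab, hEr, hE⟩ := exists_elementaryAbelian_detecting hp hodd hS hcyc
  have hPE : P ≤ Subgroup.normalizer (E : Set S) := fun x hx =>
    Subgroup.mem_normalizer_of_conj_mem (hEn x (Subgroup.le_normalizer hx))
  have hfmem : ∀ x ∈ P, f x ∈ P := fun x => mem_of_image_eq hfP
  obtain ⟨f', hf', hf'P, hf'f, hff'⟩ := hf.exists_inverse hfP
  have hf'mem : ∀ x ∈ P, f' x ∈ P := fun x => mem_of_image_eq hf'P
  -- The restriction of `f⁻¹` to `A = f(E)` belongs to `𝒢`.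
  have hfE : 𝒢.Mor E f := hab E f hEab hEr (hf.mono hEP)
  let A := hfE.image
  have hAP : A ≤ P := by
    rintro _ ⟨e, he, rfl⟩
    exact hfmem e (hEP he)
  have hf'A : 𝒢.Mor A f' := by
    obtain ⟨g, hg, -, hgf, -⟩ := hfE.exists_inverse hfE.coe_image.symm
    refine hg.congr ?_
    rintro _ ⟨e, he, rfl⟩
    rw [hgf e he, hf'f e (hEP he)]
  obtain ⟨E', hEE', hE'a, hE'r⟩ := h𝒢 E
  obtain ⟨t, ht, htE⟩ := hEE'.exists_mor
  obtain ⟨θ, hθ, hθE⟩ := hE'r.exists_mor_normalizer hS hE'a ht htE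
  have hf'AE : ∀ y ∈ A, f' y ∈ E := by
    rintro _ ⟨e, he, rfl⟩
    rwa [hf'f e (hEP he)]
  have hφ : 𝒢.Mor A (θ ∘ f') :=
    hθ.comp hf'A fun y hy => Subgroup.le_normalizer (hf'AE y hy)
  have hφA : (θ ∘ f') '' A = E' := by
    rw [Set.image_comp, ← hθE]
    congr 1
    ext y
    constructor
    · rintro ⟨z, hz, rfl⟩
      exact hf'AE z hz
    · exact fun hy => ⟨f y, ⟨y, hy, rfl⟩, hf'f y (hEP hy)⟩
  obtain ⟨N, ψ, hψ, -, hψφ, hN⟩ := hE'r.exists_extension hφ hφA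
  have hPN : P ≤ N := by
    intro x hx
    refine hN x (Subgroup.mem_normalizer_of_conj_mem ?_) (θ (f' x)) ?_ ?_
    · rintro _ ⟨e, he, rfl⟩
      refine ⟨f' x * e * (f' x)⁻¹, hEn _ (Subgroup.le_normalizer (hf'mem x hx)) e he, ?_⟩
      rw [hf.map_conj (hf'mem x hx) (hEP he), hff' x hx]
    · exact hθ.map_mem_normalizer Subgroup.le_normalizer hθE (hPE (hf'mem x hx))
        (hEn _ (Subgroup.le_normalizer (hf'mem x hx)))
    · intro y hy
      simp only [Function.comp_apply]
      rw [hf'.map_conj hx (hAP hy), hθ.map_conj (hPE (hf'mem x hx))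
        (Subgroup.le_normalizer (hf'AE y hy))]
  replace hψ := hψ.mono hPN
  refine mor_of_comp_mor hfmem hψ ?_
  refine hPr.mor_of_eqOn hS hPa hle ih hEP hEn hE ((hle _ _ hψ).comp hf hfmem) (hθ.mono hPE)
    fun e he => ?_
  rw [Function.comp_apply, hψφ (f e) ⟨e, he, rfl⟩, Function.comp_apply, hf'f e (hEP he)]

end FusionSystem

open FusionSystem in
theorem theoremB (p : ℕ) (hp : p.Prime) (hodd : Odd p) (S : Type*) [Group S] [Finite S]
    (hS : IsPGroup p S) (hcyc : ¬ IsCyclic S) (𝒢 ℱ : FusionSystem S)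
    (h𝒢 : 𝒢.IsSaturated p) (hℱ : ℱ.IsSaturated p) (hle : 𝒢 ≤ ℱ)
    (h : ∀ A B : Subgroup S,
      IsElementaryAbelian p A → 2 ≤ Group.rank A →
      IsElementaryAbelian p B → 2 ≤ Group.rank B →
      𝒢.Hom A B = ℱ.Hom A B) :
    𝒢 = ℱ := by
  have : Fact p.Prime := ⟨hp⟩
  have hle' : ∀ (R : Subgroup S) f, 𝒢.Mor R f → ℱ.Mor R f :=
    fun R f ⟨φ, hφ, hf⟩ => ⟨φ, hle _ _ hφ, hf⟩
  have hab : ∀ (A : Subgroup S) f,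
      IsElementaryAbelian p A → 2 ≤ Group.rank A → ℱ.Mor A f → 𝒢.Mor A f := by
    intro A f hA hr hf
    obtain ⟨e, he, hef⟩ := hf.exists_mulEquiv hf.coe_image.symm
    rw [mor_iff (φ := e.toMonoidHom) hef, h A _ hA hr _ (Group.rank_congr e ▸ hr)]
    · exact he.1
    · refine ⟨fun x y => e.symm.injective ?_, fun x => e.symm.injective ?_⟩
      · rw [map_mul, map_mul, hA.1]
      · rw [map_pow, hA.2, map_one]
  refine eq_of_mor_iff fun P f => ⟨hle' P f, ?_⟩
  induction hn : Nat.card S - Nat.card P using Nat.strong_induction_on generalizing P f with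
  | _ n ih =>
  subst hn
  have ih' : ∀ (R : Subgroup S) f, Nat.card P < Nat.card R → ℱ.Mor R f → 𝒢.Mor R f :=
    fun R f hR hf => ih _ (by have := Subgroup.card_le_card_group R; omega) R f rfl hf
  intro hf
  obtain ⟨Q, hPQ, hQa, hQr⟩ := hℱ P
  obtain ⟨t, ht, htP⟩ := hPQ.exists_mor
  have hcard : Nat.card Q = Nat.card P := ht.card_eq htP
  have ihQ : ∀ (R : Subgroup S) f, Nat.card Q < Nat.card R → ℱ.Mor R f → 𝒢.Mor R f := hcard ▸ ih'
  have hQ : ∀ f, ℱ.Mor Q f → f '' Q = Q → 𝒢.Mor Q f := by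
    intro f hf hfQ
    by_cases hc : IsCyclic Q
    · refine hQr.mor_of_isCyclic hS ihQ hc ?_ hf hfQ
      rintro rfl
      exact hcyc (isCyclic_of_surjective (⊤ : Subgroup S).subtype fun x => ⟨⟨x, trivial⟩, rfl⟩)
    · exact hQr.mor_of_not_isCyclic hp hodd hS h𝒢 hle' hab hQa ihQ hc hf hfQ
  by_cases hP : P = ⊤
  · subst hP
    have hfS : f '' (⊤ : Subgroup S) = (⊤ : Subgroup S) := by
      have := Subgroup.eq_top_of_card_eq hf.image (by
        rw [hf.card_eq hf.coe_image.symm, Subgroup.card_top])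
      exact congrArg SetLike.coe this
    have hQt : Q = ⊤ := Subgroup.eq_top_of_card_eq Q (by rw [hcard, Subgroup.card_top])
    subst hQt
    exact hQ f hf hfS
  -- Every `ℱ`-conjugate of `P` is `𝒢`-isomorphic to `Q`, by a map extending to its normalizer.
  have hto : ∀ R : Subgroup S, R ≠ ⊤ → Nat.card R = Nat.card P → ∀ r, ℱ.Mor R r → r '' R = Q →
      ∃ g, 𝒢.Mor R g ∧ g '' R = Q := by
    intro R hR hRP r hr hrQ
    obtain ⟨g, hg, hgQ⟩ := hQr.exists_mor_normalizer hS hQa hr hrQ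
    obtain ⟨c, hc, hcR⟩ := hS.exists_mem_normalizer_notMem_of_ne_top hR
    refine ⟨g, (ih' _ g ?_ hg).mono Subgroup.le_normalizer, hgQ⟩
    rw [← hRP]
    exact Subgroup.card_lt_card_of_mem_of_notMem Subgroup.le_normalizer hc hcR
  obtain ⟨g, hg, hgP⟩ := hto P hP rfl t ht htP
  obtain ⟨f', hf', hf'P, -, -⟩ := hf.exists_inverse hf.coe_image.symm
  have hRcard : Nat.card hf.image = Nat.card P := hf.card_eq hf.coe_image.symm
  have hRtop : hf.image ≠ ⊤ := fun h' => hP (Subgroup.eq_top_of_card_eq P (by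
    rw [← hRcard, h', Subgroup.card_top]))
  obtain ⟨g₂, hg₂, hg₂R⟩ := hto hf.image hRtop hRcard (t ∘ f')
    (ht.comp hf' fun x => mem_of_image_eq hf'P) (by rw [Set.image_comp, hf'P, htP])
  obtain ⟨g', hg', hg'Q, hg'g, -⟩ := hg.exists_inverse hgP
  -- `g₂ f g⁻¹` is an automorphism of `Q`.
  have hα : 𝒢.Mor Q (g₂ ∘ f ∘ g') := by
    refine hQ _ ((hle' _ _ hg₂).comp (hf.comp (hle' _ _ hg') fun x => mem_of_image_eq hg'Q)
      fun x hx => ⟨g' x, mem_of_image_eq hg'Q hx, rfl⟩) ?_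
    rw [Set.image_comp, Set.image_comp, hg'Q, ← hf.coe_image, hg₂R]
  refine mor_of_comp_mor (Q := hf.image) (fun x hx => ⟨x, hx, rfl⟩) hg₂
    ((hα.comp hg fun x => mem_of_image_eq hgP).congr fun x hx => ?_)
  simp only [Function.comp_apply, hg'g x hx]
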